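/- Let $n\ge 0$. Let $\mathcal T_n$ be the smallest class of finite $n$-dimensional simplicial complexes that contains the $n$-simplex and is closed under gluing two complexes $K_1,K_2\in\mathcal T_n$ along an $(n-1)$-simplex, i.e. contains $K_1\cup K_2$ whenever $K_1,K_2\in\mathcal T_n$ and $K_1\cap K_2$ is a single $(n-1)$-simplex together with its faces (for $n=0$ the $(-1)$-simplex is empty and the union is disjoint). For $K\in\mathcal T_n$ let $A_K$ be the right-angled Artin group whose presentation graph is the 1-skeleton of $K$: it has one generator for each vertex of $K$, and the defining relations say that the two generators at the ends of each edge of $K$ commute. Such a group is called a right-angled $n$-tree group. Call $K$ (and $A_K$) reducible if $K$ has a vertex that is adjacent in the 1-skeleton to all other vertices of $K$, and irreducible otherwise. Call $K$ (and $A_K$) maximally branched if each $n$-simplex of $K$ has other $n$-simplices of $K$ glued to it either along exactly one of its $(n-1)$-faces or along all of its $(n-1)$-faces, where another $n$-simplex is glued to it along an $(n-1)$-face if it contains that face. Then for each fixed $n$, any two irreducible maximally branched right-angled $n$-tree groups are quasi-isometric. That is, if $K,K'\in\mathcal T_n$ are both irreducible and maximally branched, then the finitely generated groups $A_K$ and $A_{K'}$,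 equipped with the word metrics of finite generating sets, are quasi-isometric. -/

import Mathlib

/-! ### Simplicial complexes built from simplices by gluing along codimension-one faces

Finite simplicial complexes are abstract ones, given by their set of nonempty faces; the vertices
are those `v` for which `{v}` is a face, so a complex may use only some of the points of `V`. -/

namespace NTree

/-- The full simplex on the vertex set `s`: its faces are the nonempty subsets of `s`
(there are none if `s` is empty). -/
def simplex {V : Type*} (s : Finset V) : PreAbstractSimplicialComplex V where
  faces := {t | t.Nonempty ∧ t ⊆ s}
  isRelLowerSet_faces := fun _ ht => ⟨ht.1, fun _ hut hu => ⟨hu, hut.trans ht.2⟩⟩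

/-- The class `𝒯ₙ`: the smallest class of complexes that contains every `n`-simplex and contains,
with `K₁` and `K₂`, their union along an `(n-1)`-simplex `σ`; that is, `K₁` and `K₂` intersect
exactly in the simplex `σ` together with its faces. For `n = 0` the `(-1)`-simplex is empty and the
union is disjoint. -/
inductive IsTreeComplex {V : Type*} (n : ℕ) : PreAbstractSimplicialComplex V → Prop
  | simplex (s : Finset V) (hs : s.card = n + 1) : IsTreeComplex n (NTree.simplex s)
  | union (K₁ K₂ : PreAbstractSimplicialComplex V) (σ : Finset V)
      (h₁ : IsTreeComplex n K₁) (h₂ : IsTreeComplex n K₂)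
      (hσ : σ.card = n) (hinter : K₁ ⊓ K₂ = NTree.simplex σ) : IsTreeComplex n (K₁ ⊔ K₂)

/-- The vertex set of a complex. -/
def Vertex {V : Type*} (K : PreAbstractSimplicialComplex V) : Type _ :=
  {v : V // {v} ∈ K.faces}

/-- The 1-skeleton of a complex: distinct vertices `u`, `v` are adjacent iff `{u, v}` is a face. -/
def oneSkeleton {V : Type*} (K : PreAbstractSimplicialComplex V) : SimpleGraph (Vertex K) where
  Adj u v := u ≠ v ∧ ∃ e ∈ K.faces, (e : Set V) = {u.1, v.1}
  symm := ⟨fun u v h => ⟨h.1.symm, by rw [Set.pair_comm]; exact h.2⟩⟩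
  loopless := ⟨fun _ h => h.1 rfl⟩

/-- Some vertex is at distance one from all other vertices, so that `K` is a cone. -/
def IsReducible {V : Type*} (K : PreAbstractSimplicialComplex V) : Prop :=
  ∃ v : Vertex K, ∀ w : Vertex K, w ≠ v → (oneSkeleton K).Adj v w

/-- Another `n`-simplex of `K` is glued to the `n`-simplex `s` along its `(n-1)`-face `t`. -/
def IsGluedAlong {V : Type*} (n : ℕ) (K : PreAbstractSimplicialComplex V)
    (s t : Finset V) : Prop :=
  ∃ s' ∈ K.faces, s'.card = n + 1 ∧ s' ≠ s ∧ t ⊆ s'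

/-- Every `n`-simplex of `K` has other `n`-simplices glued to it either along exactly one of its
`(n-1)`-faces or along all of them. -/
def IsMaximallyBranched {V : Type*} (n : ℕ) (K : PreAbstractSimplicialComplex V) : Prop :=
  ∀ s ∈ K.faces, s.card = n + 1 →
    (∃! t : Finset V, (t ⊆ s ∧ t.card = n) ∧ IsGluedAlong n K s t) ∨
    (∀ t : Finset V, t ⊆ s → t.card = n → IsGluedAlong n K s t)

end NTree

/-- The right-angled Artin group with presentation graph `G`: one generator for each vertex, and a
commutation relation for each edge. -/
abbrev RightAngledArtinGroup {V : Type*} (G : SimpleGraph V) : Type _ :=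
  PresentedGroup {r : FreeGroup V | ∃ u v, G.Adj u v ∧
    r = FreeGroup.of u * FreeGroup.of v * (FreeGroup.of u)⁻¹ * (FreeGroup.of v)⁻¹}

/-- The right-angled Artin group `A_K` whose presentation graph is the 1-skeleton of `K`. -/
abbrev NTree.artinGroup {V : Type*} (K : PreAbstractSimplicialComplex V) : Type _ :=
  RightAngledArtinGroup (NTree.oneSkeleton K)

/-- `f` is a quasi-isometry with respect to the distance functions `dX` and `dY`. -/
def IsQuasiIsometry {X Y : Type*} (dX : X → X → ℝ) (dY : Y → Y → ℝ) (f : X → Y) : Prop :=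
  ∃ L C : ℝ, 1 ≤ L ∧ 0 ≤ C ∧
    (∀ x x', L⁻¹ * dX x x' - C ≤ dY (f x) (f x') ∧ dY (f x) (f x') ≤ L * dX x x' + C) ∧
    ∀ y, ∃ x, dY (f x) y ≤ C

/-- The word metric of a group with respect to a generating set `S`, as the distance in the
Cayley graph. -/
noncomputable def wordDist {G : Type*} [Group G] (S : Set G) (g h : G) : ℝ :=
  ((SimpleGraph.mulCayley S).dist g h : ℝ)

/-- Two groups are quasi-isometric: both are finitely generated, and there is a quasi-isometry
between them for the word metrics of some finite generating sets (the choice of which does not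
matter, since any two word metrics on a group are bilipschitz equivalent). -/
def AreQuasiIsometricGroups (G H : Type*) [Group G] [Group H] : Prop :=
  ∃ (S : Set G) (T : Set H), S.Finite ∧ T.Finite ∧
    Subgroup.closure S = ⊤ ∧ Subgroup.closure T = ⊤ ∧
    ∃ f : G → H, IsQuasiIsometry (wordDist S) (wordDist T) f

/-!
The Artin groups in question are all quasi-isometric to one and the same graph, which depends only
on `n`.

**Flats.** Colour the vertices of `K` with `n + 1` colours so that the vertices of every `n`-simplex
have distinct colours. For each `n`-simplex `s` the cosets of the subgroup generated by its vertices
are copies of `ℤⁿ⁺¹`, with coordinates indexed by the colours, and `A_K` is a tree of such flats: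
two flats that belong to simplices with a common `(n-1)`-face meet in hyperplanes `{x c = k}`, where
`c` is the colour missing from the face. Only the flats of *inner* simplices, those glued along all
of their faces, are kept. Maximal branching says that any other simplex is glued along a single
face, so that its apex only gives an additional way of passing between flats in direction `c`.
Irreducibility provides an inner simplex to start from (`NTree.IsTreeComplex.exists_isInner`).

The inner simplices are the vertices of a finite graph (`NTree.Branching.graph`) whose edges are the
gluings to parent simplices, together with loops for the other simplices. The flats are the reduced
paths in the graph with one copy of each edge for each level `k : ℤ`. Points of these flats form
`ColoredGraph.flatGraph`. To compare it with the Cayley graph of `A_K`, the group is made to act on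
the points of the flats over the first simplex, by translations and crossings of hyperplanes
(`NTree.Branching.action`); in the other direction paths are evaluated in the group
(`ColoredGraph.Labelling.eval`). The two maps are inverse to each other up to a bounded error
(`ColoredGraph.Labelling.coarselyEquivalent`), so that no normal form theorem for `A_K` is needed.

**The model.** In `modelGraph` the flats are indexed by all words in colours and levels: each flat
has exactly one child for each colour and level. In the tree of reduced paths the number of children
varies, but it is bounded, and it is positive if pairs of consecutive levels are merged, since inner
simplices are glued along all their faces. Keeping the first child in its place and attaching its
siblings to the first child, where room is made by a shift as in Hilbert's hotel, gives a bijection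
between reduced paths and words (`ColoredGraph.pathEquiv`). It preserves the coordinates of the
flats, up to the merging of levels, and distorts adjacency of flats by a bounded amount
(`ColoredGraph.coarselyEquivalent_modelGraph`).
-/

/-! ### Coarse equivalence of graphs -/

namespace SimpleGraph

variable {X Y Z : Type*}

/-- Two graphs are coarsely equivalent if there are maps between their vertex sets, in both
directions, that move adjacent vertices to vertices at bounded distance and are inverse to each
other up to a bounded distance. The extended distance is used, so that bounds also assert that the
vertices in question are joined by a path. -/
def CoarselyEquivalent (Γ : SimpleGraph X) (Δ : SimpleGraph Y) : Prop :=
  ∃ (f : X → Y) (g : Y → X) (L : ℕ),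
    (∀ x x', Γ.Adj x x' → Δ.edist (f x) (f x') ≤ L) ∧
    (∀ y y', Δ.Adj y y' → Γ.edist (g y) (g y') ≤ L) ∧
    (∀ x, Γ.edist (g (f x)) x ≤ L) ∧ ∀ y, Δ.edist (f (g y)) y ≤ L

lemma edist_le_add {Γ : SimpleGraph X} {u v w : X} {a b : ℕ} (h₁ : Γ.edist u v ≤ a)
    (h₂ : Γ.edist v w ≤ b) : Γ.edist u w ≤ ((a + b : ℕ) : ℕ∞) := by
  push_cast
  exact Γ.edist_triangle.trans (add_le_add h₁ h₂)

lemma edist_le_of_le {Γ : SimpleGraph X} {u v : X} {a b : ℕ} (h : Γ.edist u v ≤ a) (hab : a ≤ b) :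
    Γ.edist u v ≤ b :=
  h.trans (by exact_mod_cast hab)

lemma edist_map_le {Γ : SimpleGraph X} {Δ : SimpleGraph Y} {f : X → Y} {L : ℕ}
    (hf : ∀ x x', Γ.Adj x x' → Δ.edist (f x) (f x') ≤ L) {x x' : X} {d : ℕ}
    (h : Γ.edist x x' ≤ d) : Δ.edist (f x) (f x') ≤ ((L * d : ℕ) : ℕ∞) := by
  obtain ⟨p, hp⟩ := exists_walk_of_edist_ne_top (ne_top_of_le_ne_top (ENat.natCast_ne_top d) h)
  have key : ∀ {u v : X} (p : Γ.Walk u v), Δ.edist (f u) (f v) ≤ ((L * p.length : ℕ) : ℕ∞) := by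
    intro u v p
    induction p with
    | nil => simp
    | cons hadj q ih =>
      refine edist_le_of_le (edist_le_add (hf _ _ hadj) ih) ?_
      rw [Walk.length_cons, mul_add, mul_one, add_comm]
  refine edist_le_of_le (key p) (Nat.mul_le_mul_left _ ?_)
  rw [← hp] at h
  exact_mod_cast h

theorem CoarselyEquivalent.symm {Γ : SimpleGraph X} {Δ : SimpleGraph Y}
    (h : CoarselyEquivalent Γ Δ) : CoarselyEquivalent Δ Γ := by
  obtain ⟨f, g, L, h₁, h₂, h₃, h₄⟩ := h
  exact ⟨g, f, L, h₂, h₁, h₄, h₃⟩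

theorem CoarselyEquivalent.trans {Γ : SimpleGraph X} {Δ : SimpleGraph Y} {Θ : SimpleGraph Z}
    (h : CoarselyEquivalent Γ Δ) (h' : CoarselyEquivalent Δ Θ) : CoarselyEquivalent Γ Θ := by
  obtain ⟨f, g, L, h₁, h₂, h₃, h₄⟩ := h
  obtain ⟨f', g', L', h₁', h₂', h₃', h₄'⟩ := h'
  refine ⟨f' ∘ f, g ∘ g', L * L' + L + L', fun x x' hx => ?_, fun z z' hz => ?_, fun x => ?_,
    fun z => ?_⟩
  · exact edist_le_of_le (edist_map_le h₁' (h₁ x x' hx)) (by nlinarith)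
  · exact edist_le_of_le (edist_map_le h₂ (h₂' z z' hz)) (by nlinarith)
  · exact edist_le_of_le (edist_le_add (edist_map_le h₂ (h₃' (f x))) (h₃ x)) (by nlinarith)
  · exact edist_le_of_le (edist_le_add (edist_map_le h₁' (h₄ (g' z))) (h₄' z)) (by nlinarith)

lemma edist_fromRel_le_one {r : X → X → Prop} {a b : X} (h : r a b) :
    (SimpleGraph.fromRel r).edist a b ≤ 1 := by
  rw [edist_le_one_iff_adj_or_eq, fromRel_adj]
  by_cases hab : a = b
  · exact Or.inr hab
  · exact Or.inl ⟨hab, Or.inl h⟩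

lemma edist_le_of_adj_fromRel {r : X → X → Prop} {Δ : SimpleGraph Y} {f : X → Y} {L : ℕ}
    (hf : ∀ a b, r a b → Δ.edist (f a) (f b) ≤ L) {a b : X}
    (h : (SimpleGraph.fromRel r).Adj a b) : Δ.edist (f a) (f b) ≤ L := by
  rcases (fromRel_adj _ _ _).1 h with ⟨_, h | h⟩
  · exact hf _ _ h
  · rw [edist_comm]
    exact hf _ _ h

lemma edist_mulCayley_mul_le_one {G : Type*} [Group G] {S : Set G} {a s : G}
    (hs : s ∈ S ∨ s⁻¹ ∈ S ∨ s = 1) : (mulCayley S).edist a (a * s) ≤ 1 := by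
  rw [edist_le_one_iff_adj_or_eq, mulCayley_adj']
  by_cases h : a = a * s
  · exact Or.inr h
  · refine Or.inl ⟨h, ?_⟩
    rcases hs with hs | hs | rfl
    · exact ⟨s, hs, Or.inl rfl⟩
    · exact ⟨s⁻¹, hs, Or.inr (by simp)⟩
    · simp at h

lemma mulCayley_connected {G : Type*} [Group G] {S : Set G} (hS : Subgroup.closure S = ⊤) :
    (mulCayley S).Connected := by
  have key : ∀ g : G, ∀ a : G, (mulCayley S).Reachable a (a * g) := by
    intro g
    have hg : g ∈ Subgroup.closure S := hS ▸ Subgroup.mem_top g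
    induction hg using Subgroup.closure_induction with
    | mem s hs =>
      intro a
      exact reachable_of_edist_ne_top (ne_top_of_le_ne_top (ENat.natCast_ne_top 1)
        (edist_mulCayley_mul_le_one (Or.inl hs)))
    | one => intro a; simp
    | mul x y _ _ hx hy =>
      intro a
      rw [← mul_assoc]
      exact (hx a).trans (hy _)
    | inv x _ hx =>
      intro a
      simpa using (hx (a * x⁻¹)).symm
  exact ⟨fun a b => by simpa using key (a⁻¹ * b) a⟩

theorem CoarselyEquivalent.areQuasiIsometricGroups {G H : Type*} [Group G] [Group H] {S : Set G}
    {T : Set H} (hS : S.Finite) (hT : T.Finite) (hS' : Subgroup.closure S = ⊤)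
    (hT' : Subgroup.closure T = ⊤) (h : CoarselyEquivalent (mulCayley S) (mulCayley T)) :
    AreQuasiIsometricGroups G H := by
  obtain ⟨f, g, L₀, h₁, h₂, h₃, h₄⟩ := h
  obtain ⟨L, hL₀, hL⟩ : ∃ L : ℕ, L₀ ≤ L ∧ 2 ≤ L := ⟨L₀ + 2, by omega, by omega⟩
  have cS := mulCayley_connected hS'
  have cT := mulCayley_connected hT'
  have eS : ∀ a b : G, (mulCayley S).edist a b = (mulCayley S).dist a b := fun a b =>
    ((cS.preconnected a b).coe_dist_eq_edist).symm
  have eT : ∀ a b : H, (mulCayley T).edist a b = (mulCayley T).dist a b := fun a b =>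
    ((cT.preconnected a b).coe_dist_eq_edist).symm
  have hf : ∀ a b, (mulCayley T).dist (f a) (f b) ≤ L * (mulCayley S).dist a b := fun a b => by
    have := edist_map_le (fun x x' hx => edist_le_of_le (h₁ x x' hx) hL₀) (eS a b).le
    rw [eT] at this
    exact_mod_cast this
  have hg : ∀ a b, (mulCayley S).dist (g a) (g b) ≤ L * (mulCayley T).dist a b := fun a b => by
    have := edist_map_le (fun x x' hx => edist_le_of_le (h₂ x x' hx) hL₀) (eT a b).le
    rw [eS] at this
    exact_mod_cast this
  have hgf : ∀ a, (mulCayley S).dist (g (f a)) a ≤ L := fun a => by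
    have := edist_le_of_le (h₃ a) hL₀
    rw [eS] at this
    exact_mod_cast this
  have hfg : ∀ b, (mulCayley T).dist (f (g b)) b ≤ L := fun a => by
    have := edist_le_of_le (h₄ a) hL₀
    rw [eT] at this
    exact_mod_cast this
  have hL0 : (0 : ℝ) < L := by exact_mod_cast (by omega : 0 < L)
  refine ⟨S, T, hS, hT, hS', hT', f, L, L, by exact_mod_cast (by omega : 1 ≤ L), hL0.le,
    fun a b => ⟨?_, ?_⟩, fun b => ⟨g b, ?_⟩⟩
  · have h5 : (mulCayley S).dist a b ≤ 2 * L + L * (mulCayley T).dist (f a) (f b) := by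
      have t₁ := cS.dist_triangle (u := a) (v := g (f a)) (w := b)
      have t₂ := cS.dist_triangle (u := g (f a)) (v := g (f b)) (w := b)
      have := hg (f a) (f b)
      have := hgf b
      have h6 := hgf a
      rw [dist_comm] at h6
      omega
    have h7 : (wordDist S a b : ℝ) ≤ 2 * L + L * wordDist T (f a) (f b) := by
      unfold wordDist
      exact_mod_cast h5
    have h8 : (L : ℝ)⁻¹ * wordDist S a b ≤ 2 + wordDist T (f a) (f b) := by
      rw [inv_mul_le_iff₀ hL0]
      linarith
    have : (2 : ℝ) ≤ L := by exact_mod_cast hL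
    linarith
  · have : (wordDist T (f a) (f b) : ℝ) ≤ L * wordDist S a b := by
      unfold wordDist
      exact_mod_cast hf a b
    linarith
  · unfold wordDist
    exact_mod_cast hfg b

end SimpleGraph

/-! ### Graphs over a lattice -/

section LevelGraph

variable {P P' : Type*} {m : ℕ}

/-- The graph obtained from copies `{p} × ℤᵐ` of the lattice `ℤᵐ`, one for each `p : P`, by joining
the points of the hyperplane `{x c = k}` of the copy of `p` to the corresponding points of the copy
of `p'` whenever `r p p' c k` holds. -/
def levelGraph (r : P → P → Fin m → ℤ → Prop) : SimpleGraph (P × (Fin m → ℤ)) :=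
  SimpleGraph.fromRel fun y y' =>
    (y'.1 = y.1 ∧ ∃ c, y'.2 = Function.update y.2 c (y.2 c + 1)) ∨
    (y'.2 = y.2 ∧ ∃ c, r y.1 y'.1 c (y.2 c))

variable {r : P → P → Fin m → ℤ → Prop}

namespace levelGraph

open SimpleGraph

lemma edist_update_succ (p : P) (x : Fin m → ℤ) (c : Fin m) :
    (levelGraph r).edist (p, x) (p, Function.update x c (x c + 1)) ≤ 1 :=
  edist_fromRel_le_one (Or.inl ⟨rfl, c, rfl⟩)

lemma edist_cross {p p' : P} {x : Fin m → ℤ} {c : Fin m} (h : r p p' c (x c)) :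
    (levelGraph r).edist (p, x) (p', x) ≤ 1 :=
  edist_fromRel_le_one (Or.inr ⟨rfl, c, h⟩)

lemma edist_update_add (p : P) (x : Fin m → ℤ) (c : Fin m) (k : ℕ) :
    (levelGraph r).edist (p, x) (p, Function.update x c (x c + k)) ≤ k := by
  induction k with
  | zero => simp
  | succ k ih =>
    have := edist_update_succ (r := r) p (Function.update x c (x c + k)) c
    rw [Function.update_idem, Function.update_self] at this
    have h2 := edist_le_add ih this
    rwa [add_assoc] at h2

lemma edist_update (p : P) (x : Fin m → ℤ) (c : Fin m) (k : ℤ) :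
    (levelGraph r).edist (p, x) (p, Function.update x c k) ≤ (k - x c).natAbs := by
  rcases le_total (x c) k with h | h
  · have := edist_update_add (r := r) p x c (k - x c).natAbs
    rwa [show x c + ((k - x c).natAbs : ℤ) = k by omega] at this
  · have := edist_update_add (r := r) p (Function.update x c k) c (k - x c).natAbs
    rw [Function.update_self, Function.update_idem,
      show k + ((k - x c).natAbs : ℤ) = x c by omega, Function.update_eq_self] at this
    rwa [edist_comm]

lemma edist_cross_of_le {p p' : P} {x : Fin m → ℤ} {c : Fin m} {k : ℤ} (h : r p p' c k) {B : ℕ}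
    (hB : (k - x c).natAbs ≤ B) :
    (levelGraph r).edist (p, x) (p', x) ≤ ((2 * B + 1 : ℕ) : ℕ∞) := by
  have h₁ := edist_update (r := r) p x c k
  have h₂ : (levelGraph r).edist (p, Function.update x c k) (p', Function.update x c k) ≤ (1 : ℕ) :=
    edist_cross (c := c) (by simpa using h)
  have h₃ := edist_update (r := r) p' x c k
  rw [edist_comm] at h₃
  exact edist_le_of_le (edist_le_add (edist_le_add h₁ h₂) h₃) (by omega)

lemma edist_le_sum (p : P) (x x' : Fin m → ℤ) :
    (levelGraph r).edist (p, x) (p, x') ≤ ((∑ c, (x' c - x c).natAbs : ℕ) : ℕ∞) := by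
  have key : ∀ s : Finset (Fin m), (levelGraph r).edist (p, x) (p, s.piecewise x' x) ≤
      ((∑ c ∈ s, (x' c - x c).natAbs : ℕ) : ℕ∞) := by
    intro s
    induction s using Finset.induction_on with
    | empty => simp
    | insert c s hc ih =>
      have h := edist_update (r := r) p (s.piecewise x' x) c (x' c)
      rw [Finset.piecewise_eq_of_notMem _ _ _ hc] at h
      rw [Finset.piecewise_insert, Finset.sum_insert hc]
      exact edist_le_of_le (edist_le_add ih h) (by omega)
  simpa using key Finset.univ

/-- A bijection that moves the crossings a bounded distance yields a coarse equivalence of graphs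
over a lattice, which halves the lattice coordinates. -/
theorem coarselyEquivalent {r' : P' → P' → Fin m → ℤ → Prop} (φ : P ≃ P') (B : ℕ)
    (h₁ : ∀ p p' c (x : Fin m → ℤ), r p p' c (x c) →
      (levelGraph r').edist (φ p, fun d => x d / 2) (φ p', fun d => x d / 2) ≤ B)
    (h₂ : ∀ p p' c (x : Fin m → ℤ), r' p p' c (x c) →
      (levelGraph r).edist (φ.symm p, fun d => 2 * x d) (φ.symm p', fun d => 2 * x d) ≤ B) :
    CoarselyEquivalent (levelGraph r) (levelGraph r') := by
  have aux : ∀ (x : Fin m → ℤ) (c : Fin m) (k : ℤ) (g : ℤ → ℤ),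
      (fun d => g (Function.update x c k d)) = Function.update (fun d => g (x d)) c (g k) :=
    fun x c k g => Function.comp_update g x c k
  refine ⟨fun y => (φ y.1, fun d => y.2 d / 2), fun y => (φ.symm y.1, fun d => 2 * y.2 d),
    B + 2 + m, ?_, ?_, ?_, ?_⟩
  · intro a b hab
    refine edist_le_of_adj_fromRel (f := fun y : P × (Fin m → ℤ) => (φ y.1, fun d => y.2 d / 2))
      ?_ hab
    rintro ⟨p, x⟩ ⟨p', x'⟩ (⟨hp, c, hx⟩ | ⟨hx, c, hr⟩)
    · simp only at hp hx
      subst hp hx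
      rw [aux x c (x c + 1) (fun z => z / 2)]
      refine edist_le_of_le (edist_update (r := r') (φ p') (fun d => x d / 2) c _) ?_
      omega
    · simp only at hx hr
      subst hx
      exact edist_le_of_le (h₁ p p' c x' hr) (by omega)
  · intro a b hab
    refine edist_le_of_adj_fromRel
      (f := fun y : P' × (Fin m → ℤ) => (φ.symm y.1, fun d => 2 * y.2 d)) ?_ hab
    rintro ⟨p, x⟩ ⟨p', x'⟩ (⟨hp, c, hx⟩ | ⟨hx, c, hr⟩)
    · simp only at hp hx
      subst hp hx
      rw [aux x c (x c + 1) (fun z => 2 * z)]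
      refine edist_le_of_le (edist_update (r := r) (φ.symm p') (fun d => 2 * x d) c _) ?_
      omega
    · simp only at hx hr
      subst hx
      exact edist_le_of_le (h₂ p p' c x' hr) (by omega)
  · rintro ⟨p, x⟩
    simp only [Equiv.symm_apply_apply]
    refine edist_le_of_le (edist_le_sum p _ _) ?_
    have : ∑ c, (x c - 2 * (x c / 2)).natAbs ≤ ∑ _c : Fin m, 1 :=
      Finset.sum_le_sum fun c _ => by omega
    simp only [Finset.sum_const, Finset.card_univ, Fintype.card_fin, smul_eq_mul, mul_one] at this
    omega
  · rintro ⟨p, x⟩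
    simp

end levelGraph

end LevelGraph

/-! ### Edge-coloured graphs and the tree of their reduced paths -/

/-- A graph (loops and multiple edges allowed) with vertex set `I`, given by its set `H` of oriented
edges and the reversal of orientation, with a base vertex and edges coloured by `Fin m`. -/
structure ColoredGraph (m : ℕ) (I H : Type*) where
  /-- The initial vertex of an oriented edge. -/
  src : H → I
  /-- The same edge with the opposite orientation. -/
  inv : H → H
  inv_inv : ∀ h, inv (inv h) = h
  /-- The colour of an edge. -/
  col : H → Fin m
  col_inv : ∀ h, col (inv h) = col h
  /-- The base vertex. -/
  root : I

namespace ColoredGraph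

variable {m : ℕ} {I H : Type*} (G : ColoredGraph m I H)

/-- The terminal vertex of an oriented edge. -/
def tgt (h : H) : I := G.src (G.inv h)

/-- The endpoint of an edge path starting at the base vertex. The letters of a path are edges
together with a level in `ℤ`; the head of the list is the last letter of the path. -/
def endpt : List (H × ℤ) → I
  | [] => G.root
  | l :: _ => G.tgt l.1

/-- The letter `l` extends the path `L` to a reduced path: it starts at the endpoint of `L` and does
not cancel with the last letter of `L`. -/
def Extends (L : List (H × ℤ)) (l : H × ℤ) : Prop :=
  G.src l.1 = G.endpt L ∧ L.head? ≠ some (G.inv l.1, l.2)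

/-- Reduced edge paths starting at the base vertex, in the graph with one copy of each edge for each
level in `ℤ`. -/
def IsPath : List (H × ℤ) → Prop
  | [] => True
  | l :: L => IsPath L ∧ G.Extends L l

/-- The set of reduced paths, that is, the vertex set of the universal cover. -/
abbrev Path : Type _ := {L : List (H × ℤ) // G.IsPath L}

/-- The graph over the lattice `ℤᵐ` with one copy of the lattice (a flat) for each reduced path, two
flats being joined along the hyperplane at level `k` in direction `c` if one path extends the other
by an edge of colour `c` and level `k`. -/
abbrev flatGraph : SimpleGraph (G.Path × (Fin m → ℤ)) :=
  levelGraph fun L L' c k => ∃ h, G.col h = c ∧ L'.1 = (h, k) :: L.1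

/-- The analogous graph over the lattice with flats indexed by all words in colours and levels, so
that each flat has exactly one child for each colour and level. -/
abbrev _root_.modelGraph (m : ℕ) : SimpleGraph (List (Fin m × ℤ) × (Fin m → ℤ)) :=
  levelGraph fun A A' c k => A' = (c, k) :: A

lemma edist_flatGraph_cons {L : List (H × ℤ)} {l : H × ℤ} (hL : G.IsPath (l :: L))
    {x : Fin m → ℤ} {B : ℕ} (h : (l.2 - x (G.col l.1)).natAbs ≤ B) :
    G.flatGraph.edist (⟨L, hL.1⟩, x) (⟨l :: L, hL⟩, x) ≤ ((2 * B + 1 : ℕ) : ℕ∞) :=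
  levelGraph.edist_cross_of_le (c := G.col l.1) (k := l.2) ⟨l.1, rfl, rfl⟩ h

/-! ### Bijection between reduced paths and words -/

/-- The colour of a letter and its level divided by two. -/
def block (l : H × ℤ) : Fin m × ℤ := (G.col l.1, l.2 / 2)

open Classical in
/-- The letters in a block that extend a path to a reduced path. Two levels per block are enough to
make this list nonempty: the last letter of the path excludes at most one of them. -/
noncomputable def children [Fintype H] (L : List (H × ℤ)) (μ : Fin m × ℤ) : List (H × ℤ) :=
  ((Finset.univ : Finset H).toList ×ˢ [2 * μ.2, 2 * μ.2 + 1]).filter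
    fun l => G.Extends L l ∧ G.block l = μ

/-- Shifts the levels of one colour, from a given level on, up by `q`, which makes room for `q` new
children, as in Hilbert's hotel. -/
def shift (q : ℕ) (ν : Option (Fin m × ℤ)) (μ : Fin m × ℤ) : Fin m × ℤ :=
  match ν with
  | none => μ
  | some ν => if μ.1 = ν.1 ∧ ν.2 ≤ μ.2 then (μ.1, μ.2 + q) else μ

/-- The `k`-th of the `q` levels that `shift q ν` leaves free is recognised as `some k`. -/
def slot (q : ℕ) (ν : Option (Fin m × ℤ)) (μ : Fin m × ℤ) : Option ℕ :=
  match ν with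
  | none => none
  | some ν => if μ.1 = ν.1 ∧ ν.2 ≤ μ.2 ∧ μ.2 < ν.2 + q then some (μ.2 - ν.2).toNat else none

/-- The inverse of `shift q ν`, away from the levels that it leaves free. -/
def unshift (q : ℕ) (ν : Option (Fin m × ℤ)) (μ : Fin m × ℤ) : Fin m × ℤ :=
  match ν with
  | none => μ
  | some ν => if μ.1 = ν.1 ∧ ν.2 ≤ μ.2 then (μ.1, μ.2 - q) else μ

lemma slot_shift (q : ℕ) (ν : Option (Fin m × ℤ)) (μ : Fin m × ℤ) :
    slot q ν (shift q ν μ) = none := by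
  rcases ν with _ | ν
  · rfl
  · simp only [slot, shift]
    split_ifs with h₁ h₂ h₂ <;> first | rfl | omega

lemma unshift_shift (q : ℕ) (ν : Option (Fin m × ℤ)) (μ : Fin m × ℤ) :
    unshift q ν (shift q ν μ) = μ := by
  rcases ν with _ | ν
  · rfl
  · obtain ⟨c, k⟩ := μ
    simp only [unshift, shift]
    split_ifs with h₁
    · simp
    · grind
    · rfl

lemma shift_unshift {q : ℕ} {ν : Option (Fin m × ℤ)} {μ : Fin m × ℤ} (h : slot q ν μ = none) :
    shift q ν (unshift q ν μ) = μ := by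
  rcases ν with _ | ν
  · rfl
  · obtain ⟨c, k⟩ := μ
    simp only [slot, ite_eq_right_iff, reduceCtorEq, imp_false] at h
    simp only [unshift, shift]
    split_ifs with h₁ h₂
    · simp
    · exact absurd ⟨h₁.1, by by_contra h₃; exact h ⟨h₁.1, h₁.2, by omega⟩⟩ h₂
    · rfl

lemma slot_some {q k : ℕ} (hk : k < q) (ν : Fin m × ℤ) :
    slot q (some ν) (ν.1, ν.2 + k) = some k := by
  simp only [slot]
  rw [if_pos ⟨trivial, by omega, by omega⟩]
  simp

lemma exists_of_slot_eq_some {q j : ℕ} {ν : Option (Fin m × ℤ)} {μ : Fin m × ℤ}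
    (h : slot q ν μ = some j) : ∃ ν', ν = some ν' ∧ μ = (ν'.1, ν'.2 + j) ∧ j < q := by
  rcases ν with _ | ν
  · simp [slot] at h
  · simp only [slot] at h
    split_ifs at h with h₁
    obtain ⟨c, k⟩ := μ
    simp only [Option.some.injEq] at h
    simp only at h₁
    refine ⟨ν, rfl, Prod.ext h₁.1 ?_, ?_⟩ <;> grind

lemma shift_fst (q : ℕ) (ν : Option (Fin m × ℤ)) (μ : Fin m × ℤ) :
    (shift q ν μ).1 = μ.1 := by
  rcases ν with _ | ν
  · rfl
  · simp only [shift]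
    split_ifs <;> rfl

lemma natAbs_shift_le (q : ℕ) (ν : Option (Fin m × ℤ)) (μ : Fin m × ℤ) :
    ((shift q ν μ).2 - μ.2).natAbs ≤ q := by
  rcases ν with _ | ν
  · simp [shift]
  · simp only [shift]
    split_ifs <;> simp

variable [Fintype H]

lemma mem_children {L : List (H × ℤ)} {μ : Fin m × ℤ} {l : H × ℤ} :
    l ∈ G.children L μ ↔ G.Extends L l ∧ G.block l = μ := by
  unfold children
  rw [List.mem_filter]
  simp only [decide_eq_true_eq, and_iff_right_iff_imp]
  rintro ⟨-, rfl⟩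
  obtain ⟨h, k⟩ := l
  refine List.pair_mem_product.2 ⟨Finset.mem_toList.2 (Finset.mem_univ _), ?_⟩
  simp only [block, List.mem_cons, List.not_mem_nil, or_false]
  omega

lemma nodup_children (L : List (H × ℤ)) (μ : Fin m × ℤ) : (G.children L μ).Nodup := by
  refine List.Nodup.filter _ (List.Nodup.product (Finset.nodup_toList _) ?_)
  simp

lemma length_children_le (L : List (H × ℤ)) (μ : Fin m × ℤ) :
    (G.children L μ).length ≤ 2 * Fintype.card H := by
  refine (List.length_filter_le _ _).trans (le_of_eq ?_)
  simp [List.length_product, mul_comm]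

lemma length_children_pos (hG : ∀ i c, ∃ h, G.src h = i ∧ G.col h = c) (L : List (H × ℤ))
    (μ : Fin m × ℤ) : 0 < (G.children L μ).length := by
  obtain ⟨h, h₁, h₂⟩ := hG (G.endpt L) μ.1
  -- the last letter of `L` is inverse to at most one of the two letters of the block with edge `h`
  by_cases hL : L.head? = some (G.inv h, 2 * μ.2)
  · refine List.length_pos_of_mem (a := (h, 2 * μ.2 + 1)) (G.mem_children.2 ⟨⟨h₁, ?_⟩, ?_⟩)
    · rw [hL]
      simp
    · ext <;> simp [block, h₂]; omega
  · refine List.length_pos_of_mem (a := (h, 2 * μ.2)) (G.mem_children.2 ⟨⟨h₁, hL⟩, ?_⟩)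
    ext <;> simp [block, h₂]

lemma isPath_cons {L : List (H × ℤ)} {l : H × ℤ} :
    G.IsPath (l :: L) ↔ G.IsPath L ∧ l ∈ G.children L (G.block l) := by
  rw [mem_children]
  simp [IsPath]

open Classical in
/-- The position of a letter among the letters of its block. -/
noncomputable def childIndex (L : List (H × ℤ)) (l : H × ℤ) : ℕ :=
  (G.children L (G.block l)).idxOf l

/-- The number of younger siblings of a path that is the first child in its block, and `0` for all
other paths. -/
noncomputable def pending : List (H × ℤ) → ℕ
  | [] => 0
  | l :: L => if G.childIndex L l = 0 then (G.children L (G.block l)).length - 1 else 0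

/-- The word that represents a reduced path. Of the children in a block, the first one takes the
place that the word model provides for that block. Its younger siblings become children of the
first one, which frees places for them by shifting the places of its own children. A path that is
not a first child has no siblings to accommodate, so places move by a bounded amount only. -/
noncomputable def addr : List (H × ℤ) → List (Fin m × ℤ)
  | [] => []
  | l :: L =>
    let μ := shift (G.pending L) (addr L).head? (G.block l)
    match G.childIndex L l with
    | 0 => μ :: addr L
    | k + 1 => (μ.1, μ.2 + k) :: μ :: addr L

/-- The path whose last letter is the `j`-th letter of the block of the last letter of the given
path. -/
noncomputable def sibling : List (H × ℤ) → ℕ → List (H × ℤ)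
  | [], _ => []
  | l :: L, j => (G.children L (G.block l))[j]?.toList ++ L

/-- The reduced path that is represented by a word. -/
noncomputable def place : List (Fin m × ℤ) → List (H × ℤ)
  | [] => []
  | μ :: A =>
    match slot (G.pending (place A)) A.head? μ with
    | some j => G.sibling (place A) (j + 1)
    | none =>
      (G.children (place A) (unshift (G.pending (place A)) A.head? μ))[0]?.toList ++ place A

lemma childIndex_getElem {L : List (H × ℤ)} {μ : Fin m × ℤ} {j : ℕ}
    (hj : j < (G.children L μ).length) : G.childIndex L (G.children L μ)[j] = j := by
  have h : G.block (G.children L μ)[j] = μ := (G.mem_children.1 (List.getElem_mem hj)).2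
  classical
  have := List.Nodup.idxOf_getElem (G.nodup_children L μ) j hj
  unfold childIndex
  rw [h]
  convert this

lemma childIndex_lt {L : List (H × ℤ)} {l : H × ℤ} (h : G.IsPath (l :: L)) :
    G.childIndex L l < (G.children L (G.block l)).length := by
  classical
  have := List.idxOf_lt_length_iff.2 (G.isPath_cons.1 h).2
  unfold childIndex
  convert this

lemma getElem_childIndex {L : List (H × ℤ)} {l : H × ℤ} (h : G.IsPath (l :: L)) :
    (G.children L (G.block l))[G.childIndex L l]? = some l := by
  classical
  rw [List.getElem?_eq_getElem (G.childIndex_lt h)]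
  exact congrArg some (List.getElem_idxOf _)

lemma isPath_of_getElem {L : List (H × ℤ)} (hL : G.IsPath L) {μ : Fin m × ℤ} {j : ℕ}
    (hj : j < (G.children L μ).length) : G.IsPath ((G.children L μ)[j] :: L) :=
  ⟨hL, (G.mem_children.1 (List.getElem_mem hj)).1⟩

lemma block_getElem {L : List (H × ℤ)} {μ : Fin m × ℤ} {j : ℕ}
    (hj : j < (G.children L μ).length) : G.block (G.children L μ)[j] = μ :=
  (G.mem_children.1 (List.getElem_mem hj)).2

lemma addr_of_index_zero {L : List (H × ℤ)} {l : H × ℤ} (h : G.childIndex L l = 0) :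
    G.addr (l :: L) = shift (G.pending L) (G.addr L).head? (G.block l) :: G.addr L := by
  simp only [addr, h]

lemma addr_of_index_succ {L : List (H × ℤ)} {l : H × ℤ} {k : ℕ} (h : G.childIndex L l = k + 1) :
    G.addr (l :: L) = ((shift (G.pending L) (G.addr L).head? (G.block l)).1,
      (shift (G.pending L) (G.addr L).head? (G.block l)).2 + k) ::
      shift (G.pending L) (G.addr L).head? (G.block l) :: G.addr L := by
  simp only [addr, h]

/-- If a path has younger siblings to accommodate, it is a first child. -/
lemma exists_of_lt_pending {L : List (H × ℤ)} {j : ℕ} (h : j < G.pending L) :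
    ∃ l L', L = l :: L' ∧ G.childIndex L' l = 0 ∧
      j + 1 < (G.children L' (G.block l)).length := by
  rcases L with _ | ⟨l, L'⟩
  · simp [pending] at h
  · simp only [pending] at h
    split_ifs at h with h₁
    · exact ⟨l, L', rfl, h₁, by omega⟩
    · omega

lemma pending_le (L : List (H × ℤ)) : G.pending L ≤ 2 * Fintype.card H := by
  rcases L with _ | ⟨l, L'⟩
  · simp [pending]
  · have := G.length_children_le L' (G.block l)
    simp only [pending]
    split_ifs <;> omega

lemma place_of_slot_some {A : List (Fin m × ℤ)} {μ : Fin m × ℤ} {j : ℕ}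
    (h : slot (G.pending (G.place A)) A.head? μ = some j) :
    G.place (μ :: A) = G.sibling (G.place A) (j + 1) := by
  simp only [place, h]

lemma place_of_slot_none (hG : ∀ i c, ∃ h, G.src h = i ∧ G.col h = c) {A : List (Fin m × ℤ)}
    {μ : Fin m × ℤ} (h : slot (G.pending (G.place A)) A.head? μ = none) :
    G.place (μ :: A) = (G.children (G.place A) (unshift (G.pending (G.place A)) A.head? μ))[0]'
      (G.length_children_pos hG _ _) :: G.place A := by
  simp only [place, h]
  rw [List.getElem?_eq_getElem (G.length_children_pos hG _ _)]
  rfl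

lemma sibling_cons {L : List (H × ℤ)} {l : H × ℤ} {j : ℕ}
    (hj : j < (G.children L (G.block l)).length) :
    G.sibling (l :: L) j = (G.children L (G.block l))[j] :: L := by
  simp [sibling, List.getElem?_eq_getElem hj]

lemma isPath_place (hG : ∀ i c, ∃ h, G.src h = i ∧ G.col h = c) (A : List (Fin m × ℤ)) :
    G.IsPath (G.place A) := by
  induction A with
  | nil => trivial
  | cons μ A ih =>
    rcases hs : slot (G.pending (G.place A)) A.head? μ with _ | j
    · rw [G.place_of_slot_none hG hs]
      exact G.isPath_of_getElem ih _
    · rw [G.place_of_slot_some hs]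
      obtain ⟨ν, -, -, hj⟩ := exists_of_slot_eq_some hs
      obtain ⟨l, L', hL, -, hj⟩ := G.exists_of_lt_pending hj
      rw [hL] at ih ⊢
      rw [G.sibling_cons hj]
      exact G.isPath_of_getElem ih.1 _

lemma addr_place (hG : ∀ i c, ∃ h, G.src h = i ∧ G.col h = c) (A : List (Fin m × ℤ)) :
    G.addr (G.place A) = A := by
  induction A with
  | nil => rfl
  | cons μ A ih =>
    rcases hs : slot (G.pending (G.place A)) A.head? μ with _ | j
    · rw [G.place_of_slot_none hG hs, G.addr_of_index_zero (G.childIndex_getElem _), ih,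
        G.block_getElem, shift_unshift hs]
    · rw [G.place_of_slot_some hs]
      obtain ⟨ν, hν, hμ, hj⟩ := exists_of_slot_eq_some hs
      obtain ⟨l, L', hL, h0, hj⟩ := G.exists_of_lt_pending hj
      rw [hL] at ih ⊢
      rw [G.addr_of_index_zero h0] at ih
      rw [G.sibling_cons hj, G.addr_of_index_succ (G.childIndex_getElem _), G.block_getElem, ih]
      rw [← ih] at hν
      simp only [List.head?_cons, Option.some.injEq] at hν
      rw [hν, ← hμ]

lemma place_addr (hG : ∀ i c, ∃ h, G.src h = i ∧ G.col h = c) {L : List (H × ℤ)}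
    (hL : G.IsPath L) : G.place (G.addr L) = L := by
  induction L with
  | nil => rfl
  | cons l L ih =>
    specialize ih hL.1
    have first : G.place (shift (G.pending L) (G.addr L).head? (G.block l) :: G.addr L) =
        (G.children L (G.block l))[0]'(G.length_children_pos hG _ _) :: L := by
      rw [G.place_of_slot_none hG]
      · simp only [ih, unshift_shift]
      · rw [ih, slot_shift]
    have hl := G.getElem_childIndex hL
    rcases h : G.childIndex L l with _ | k
    · rw [G.addr_of_index_zero h, first]
      rw [h, List.getElem?_eq_getElem (G.length_children_pos hG _ _), Option.some.injEq] at hl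
      rw [hl]
    · have hk := G.childIndex_lt hL
      rw [h] at hk
      have hp : G.pending ((G.children L (G.block l))[0]'(G.length_children_pos hG _ _) :: L) =
          (G.children L (G.block l)).length - 1 := by
        simp only [pending]
        rw [if_pos (G.childIndex_getElem _), G.block_getElem]
      rw [G.addr_of_index_succ h, G.place_of_slot_some (j := k), first, G.sibling_cons]
      · simp only [G.block_getElem]
        rw [h, List.getElem?_eq_getElem hk, Option.some.injEq] at hl
        rw [hl]
      · rw [G.block_getElem]
        exact hk
      · rw [first, hp]
        exact slot_some (by omega) _

/-- Reduced paths correspond to words. -/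
noncomputable def pathEquiv (hG : ∀ i c, ∃ h, G.src h = i ∧ G.col h = c) :
    G.Path ≃ List (Fin m × ℤ) where
  toFun L := G.addr L.1
  invFun A := ⟨G.place A, G.isPath_place hG A⟩
  left_inv L := Subtype.ext (G.place_addr hG L.2)
  right_inv A := G.addr_place hG A

lemma edist_modelGraph_cons {A : List (Fin m × ℤ)} {c : Fin m} {k : ℤ} {x : Fin m → ℤ} {B : ℕ}
    (h : (k - x c).natAbs ≤ B) :
    (modelGraph m).edist (A, x) ((c, k) :: A, x) ≤ ((2 * B + 1 : ℕ) : ℕ∞) :=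
  levelGraph.edist_cross_of_le (c := c) (k := k) rfl h

/-- If every vertex is the start of an edge of each colour, then the graph of flats is coarsely
equivalent to the model. -/
theorem coarselyEquivalent_modelGraph (hG : ∀ i c, ∃ h, G.src h = i ∧ G.col h = c) :
    SimpleGraph.CoarselyEquivalent G.flatGraph (modelGraph m) := by
  set C := 2 * Fintype.card H with hC
  refine levelGraph.coarselyEquivalent (G.pathEquiv hG) (20 * C + 20) ?_ ?_
  · rintro ⟨L, hL⟩ ⟨L', hL'⟩ c x ⟨h, hc, rfl⟩
    set l : H × ℤ := (h, x c) with hl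
    change (modelGraph m).edist (G.addr L, _) (G.addr (l :: L), _) ≤ _
    have h₁ := shift_fst (G.pending L) (G.addr L).head? (G.block l)
    have h₂ := natAbs_shift_le (G.pending L) (G.addr L).head? (G.block l)
    have h₃ := G.pending_le L
    have h₄ : G.block l = (c, x c / 2) := by simp [block, hl, hc]
    set μ := shift (G.pending L) (G.addr L).head? (G.block l) with hμ
    obtain ⟨c', k⟩ := μ
    rw [h₄] at h₁ h₂
    simp only at h₁ h₂
    subst h₁
    have h₅ : (modelGraph m).edist (G.addr L, fun d => x d / 2)
        ((c', k) :: G.addr L, fun d => x d / 2) ≤ ((2 * C + 1 : ℕ) : ℕ∞) :=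
      edist_modelGraph_cons (h₂.trans h₃)
    rcases hi : G.childIndex L l with _ | j
    · rw [G.addr_of_index_zero hi, ← hμ]
      exact SimpleGraph.edist_le_of_le h₅ (by omega)
    · rw [G.addr_of_index_succ hi, ← hμ]
      have hj : G.childIndex L l < (G.children L (G.block l)).length := G.childIndex_lt hL'
      have := G.length_children_le L (G.block l)
      refine SimpleGraph.edist_le_of_le (SimpleGraph.edist_le_add h₅
        (edist_modelGraph_cons (B := 2 * C) ?_)) (by omega)
      simp only
      omega
  · rintro A _ c x rfl
    change G.flatGraph.edist (⟨G.place A, G.isPath_place hG A⟩, _)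
      (⟨G.place ((c, x c) :: A), G.isPath_place hG _⟩, _) ≤ _
    have hA := G.isPath_place hG ((c, x c) :: A)
    have hA' := G.isPath_place hG A
    rcases hs : slot (G.pending (G.place A)) A.head? (c, x c) with _ | j
    · have h₀ := G.place_of_slot_none hG hs
      have h₁ := shift_unshift hs
      set μ := unshift (G.pending (G.place A)) A.head? (c, x c) with hμ
      have h₂ := shift_fst (G.pending (G.place A)) A.head? μ
      have h₃ := natAbs_shift_le (G.pending (G.place A)) A.head? μ
      have h₄ := G.pending_le (G.place A)
      have h₅ := G.block_getElem (G.length_children_pos hG (G.place A) μ)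
      set l := (G.children (G.place A) μ)[0]'(G.length_children_pos hG _ _)
      have hl : G.IsPath (l :: G.place A) := h₀ ▸ hA
      have := G.edist_flatGraph_cons hl (x := fun d => 2 * x d) (B := 2 * C + 1) ?_
      · simp only [h₀]
        exact SimpleGraph.edist_le_of_le this (by omega)
      · rw [h₁] at h₂ h₃
        simp only at h₂ h₃
        rw [← h₅] at h₂ h₃
        simp only [block] at h₂ h₃
        rw [← h₂]
        omega
    · have h₀ := G.place_of_slot_some hs
      obtain ⟨ν, hν, hμ, hj'⟩ := exists_of_slot_eq_some hs
      have h₁ := G.pending_le (G.place A)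
      obtain ⟨l, L', hL, h0, hj⟩ := G.exists_of_lt_pending hj'
      rw [hL, G.sibling_cons hj] at h₀
      have hadr := G.addr_place hG A
      rw [hL, G.addr_of_index_zero h0] at hadr
      rw [← hadr] at hν
      simp only [List.head?_cons, Option.some.injEq] at hν
      have h₂ := shift_fst (G.pending L') (G.addr L').head? (G.block l)
      have h₃ := natAbs_shift_le (G.pending L') (G.addr L').head? (G.block l)
      have h₄ := G.pending_le L'
      rw [hν] at h₂ h₃
      simp only [Prod.mk.injEq] at hμ
      have h₅ := G.block_getElem hj
      set l' := (G.children L' (G.block l))[j + 1]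
      have hl' : G.IsPath (l' :: L') := h₀ ▸ hA
      have hl : G.IsPath (l :: L') := hL ▸ hA'
      have e₁ : G.col l.1 = c := by
        rw [hμ.1, h₂]
        rfl
      have e₂ : G.col l'.1 = c := by
        rw [← e₁]
        exact congrArg Prod.fst h₅
      have e₃ : l'.2 / 2 = l.2 / 2 := congrArg Prod.snd h₅
      have hlev : (l.2 / 2 - x c).natAbs ≤ 2 * C := by
        simp only [block] at h₃
        omega
      have s₁ := G.edist_flatGraph_cons hl (x := fun d => 2 * x d) (B := 4 * C + 1)
        (by simp only [e₁]; omega)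
      have s₂ := G.edist_flatGraph_cons hl' (x := fun d => 2 * x d) (B := 4 * C + 1)
        (by simp only [e₂]; omega)
      rw [SimpleGraph.edist_comm] at s₁
      simp only [h₀, hL]
      exact SimpleGraph.edist_le_of_le (SimpleGraph.edist_le_add s₁ s₂) (by omega)

end ColoredGraph

/-! ### Ordered monomials in commuting elements -/

section Monomial

variable {A : Type*} [Group A] {m : ℕ}

/-- The monomial `t₀ ^ x₀ * t₁ ^ x₁ * ⋯`. -/
def monomial (t : Fin m → A) (x : Fin m → ℤ) : A :=
  ((List.finRange m).map fun c => t c ^ x c).prod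

lemma monomial_zero (t : Fin m → A) : monomial t 0 = 1 := by
  refine List.prod_eq_one fun a ha => ?_
  obtain ⟨c, -, rfl⟩ := List.mem_map.1 ha
  simp

lemma list_prod_map_mul_comm {ι : Type*} {l : List ι} {f g : ι → A} {w : A}
    (h : ∀ i ∈ l, f i * w = w * g i) : (l.map f).prod * w = w * (l.map g).prod := by
  induction l with
  | nil => simp
  | cons i l ih =>
    rw [List.map_cons, List.prod_cons, List.map_cons, List.prod_cons, mul_assoc,
      ih fun j hj => h j (List.mem_cons_of_mem _ hj), ← mul_assoc,
      h i List.mem_cons_self, mul_assoc]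

lemma monomial_mul_comm {t t' : Fin m → A} {w : A} {x : Fin m → ℤ}
    (h : ∀ c, x c ≠ 0 → t c * w = w * t' c) : monomial t x * w = w * monomial t' x := by
  refine list_prod_map_mul_comm fun c _ => ?_
  by_cases hc : x c = 0
  · simp [hc]
  · exact (SemiconjBy.zpow_right (a := w) (x := t' c) (y := t c) (h c hc).symm (x c)).eq.symm

lemma monomial_update {t : Fin m → A} (ht : ∀ c d, Commute (t c) (t d)) (x : Fin m → ℤ)
    (c : Fin m) (k : ℤ) :
    monomial t (Function.update x c k) = monomial t x * t c ^ (k - x c) := by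
  have key : ∀ l : List (Fin m), l.Nodup →
      (l.map fun d => t d ^ Function.update x c k d).prod =
        if c ∈ l then (l.map fun d => t d ^ x d).prod * t c ^ (k - x c)
        else (l.map fun d => t d ^ x d).prod := by
    intro l hl
    induction l with
    | nil => simp
    | cons d l ih =>
      rw [List.nodup_cons] at hl
      rw [List.map_cons, List.prod_cons, List.map_cons, List.prod_cons, ih hl.2]
      by_cases hd : c = d
      · subst hd
        rw [if_neg hl.1, if_pos List.mem_cons_self, Function.update_self, mul_assoc]
        have : (l.map fun d => t d ^ x d).prod * t c ^ (k - x c) =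
            t c ^ (k - x c) * (l.map fun d => t d ^ x d).prod :=
          list_prod_map_mul_comm fun d _ => (((ht d c).zpow_left _).zpow_right _).eq
        rw [this, ← mul_assoc, ← zpow_add, add_sub_cancel]
      · rw [Function.update_of_ne (Ne.symm hd)]
        by_cases hc : c ∈ l
        · rw [if_pos hc, if_pos (List.mem_cons_of_mem _ hc), mul_assoc]
        · rw [if_neg hc, if_neg (by simp [hc, hd])]
  rw [monomial, key _ (List.nodup_finRange m), if_pos (List.mem_finRange c), monomial]

end Monomial

/-! ### Moving between flats -/

namespace ColoredGraph

open SimpleGraph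

variable {m : ℕ} {I H : Type*} (G : ColoredGraph m I H)

/-- The points of the flats whose reduced path ends at the vertex `i`. -/
abbrev FlatAt (i : I) : Type _ := {L : List (H × ℤ) // G.IsPath L ∧ G.endpt L = i} × (Fin m → ℤ)

variable {G} in
/-- A point of a flat, with the endpoint of the path forgotten. -/
def FlatAt.toPoint {i : I} (y : G.FlatAt i) : G.Path × (Fin m → ℤ) := (⟨y.1.1, y.1.2.1⟩, y.2)

/-- The origin of the flat of the empty path. -/
def base : G.FlatAt G.root := (⟨[], trivial, rfl⟩, 0)

open Classical in
/-- Appends a letter to a path and cancels it with the last letter if possible. -/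
noncomputable def step (l : H × ℤ) (L : List (H × ℤ)) : List (H × ℤ) :=
  if L.head? = some (G.inv l.1, l.2) then L.tail else l :: L

lemma step_cancel (h : H) (k : ℤ) (L : List (H × ℤ)) :
    G.step (h, k) ((G.inv h, k) :: L) = L := by
  simp [step]

lemma step_of_extends {l : H × ℤ} {L : List (H × ℤ)} (h : G.Extends L l) :
    G.step l L = l :: L := by
  rw [step, if_neg h.2]

lemma extends_or_cancel {L : List (H × ℤ)} (hL : G.IsPath L) {h : H} (k : ℤ)
    (hs : G.endpt L = G.src h) :
    G.Extends L (h, k) ∨ ∃ L', L = (G.inv h, k) :: L' ∧ G.IsPath L' ∧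
      G.Extends L' (G.inv h, k) := by
  by_cases hc : L.head? = some (G.inv h, k)
  · right
    rcases L with _ | ⟨l, L'⟩
    · simp at hc
    · simp only [List.head?_cons, Option.some.injEq] at hc
      subst hc
      exact ⟨L', rfl, hL⟩
  · exact Or.inl ⟨hs.symm, hc⟩

lemma tgt_inv (h : H) : G.tgt (G.inv h) = G.src h := by
  rw [tgt, G.inv_inv]

lemma step_spec {L : List (H × ℤ)} (hL : G.IsPath L) {h : H} (k : ℤ)
    (hs : G.endpt L = G.src h) :
    (G.IsPath (G.step (h, k) L) ∧ G.endpt (G.step (h, k) L) = G.tgt h) ∧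
      G.step (G.inv h, k) (G.step (h, k) L) = L := by
  rcases G.extends_or_cancel hL k hs with he | ⟨L', rfl, hL', he⟩
  · rw [G.step_of_extends he]
    refine ⟨⟨⟨hL, he⟩, rfl⟩, ?_⟩
    have := G.step_cancel (G.inv h) k L
    rwa [G.inv_inv] at this
  · rw [G.step_cancel]
    exact ⟨⟨hL', he.1.symm⟩, G.step_of_extends he⟩

/-- Crossing the hyperplane of colour and level prescribed by the edge `h` and the given point. -/
noncomputable def cross (h : H) : G.FlatAt (G.src h) ≃ G.FlatAt (G.tgt h) where
  toFun y := (⟨G.step (h, y.2 (G.col h)) y.1.1, (G.step_spec y.1.2.1 _ y.1.2.2).1⟩, y.2)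
  invFun y := (⟨G.step (G.inv h, y.2 (G.col h)) y.1.1, by
    have := (G.step_spec (h := G.inv h) y.1.2.1 (y.2 (G.col h)) y.1.2.2).1
    rwa [G.tgt_inv] at this⟩, y.2)
  left_inv y := by
    refine Prod.ext (Subtype.ext ?_) rfl
    exact (G.step_spec y.1.2.1 _ y.1.2.2).2
  right_inv y := by
    refine Prod.ext (Subtype.ext ?_) rfl
    have := (G.step_spec (h := G.inv h) y.1.2.1 (y.2 (G.col h)) y.1.2.2).2
    rwa [G.inv_inv] at this

/-- Translation of flats by a unit vector. -/
def translate (i : I) (c : Fin m) : Equiv.Perm (G.FlatAt i) where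
  toFun y := (y.1, Function.update y.2 c (y.2 c + 1))
  invFun y := (y.1, Function.update y.2 c (y.2 c - 1))
  left_inv y := by simp
  right_inv y := by simp

lemma edist_cross_le (h : H) (y : G.FlatAt (G.src h)) :
    G.flatGraph.edist y.toPoint (G.cross h y).toPoint ≤ 1 := by
  obtain ⟨⟨L, hL, hs⟩, x⟩ := y
  rcases G.extends_or_cancel hL (x (G.col h)) hs with he | ⟨L', hL', -, -⟩
  · exact levelGraph.edist_cross (c := G.col h) ⟨h, rfl, G.step_of_extends he⟩
  · rw [edist_comm]
    refine levelGraph.edist_cross (c := G.col h) ⟨G.inv h, G.col_inv h, ?_⟩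
    subst hL'
    exact congrArg _ (G.step_cancel h _ L').symm

lemma edist_translate_le (i : I) (c : Fin m) (y : G.FlatAt i) :
    G.flatGraph.edist y.toPoint (G.translate i c y).toPoint ≤ 1 :=
  levelGraph.edist_update_succ _ _ _

/-- Translations commute with crossings of hyperplanes parallel to them. -/
lemma cross_translate {h : H} {c : Fin m} (hc : c ≠ G.col h) (y : G.FlatAt (G.src h)) :
    G.cross h (G.translate _ c y) = G.translate _ c (G.cross h y) := by
  refine Prod.ext (Subtype.ext ?_) rfl
  change G.step (h, Function.update y.2 c (y.2 c + 1) (G.col h)) y.1.1 = _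
  rw [Function.update_of_ne hc.symm]
  rfl

lemma translate_comm (i : I) (c d : Fin m) (y : G.FlatAt i) :
    G.translate i c (G.translate i d y) = G.translate i d (G.translate i c y) := by
  by_cases hcd : c = d
  · rw [hcd]
  · refine Prod.ext rfl ?_
    change Function.update (Function.update y.2 d _) c (Function.update y.2 d _ c + 1) =
      Function.update (Function.update y.2 c _) d (Function.update y.2 c _ d + 1)
    rw [Function.update_of_ne hcd, Function.update_of_ne (Ne.symm hcd), Function.update_comm hcd]

variable {G} in
lemma FlatAt.toPoint_injective {i : I} :
    Function.Injective (FlatAt.toPoint : G.FlatAt i → G.Path × (Fin m → ℤ)) := by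
  intro y y' h
  simp only [FlatAt.toPoint, Prod.mk.injEq, Subtype.mk.injEq] at h
  exact Prod.ext (Subtype.ext h.1) h.2

lemma toPoint_cross_inv_cross (h : H) (y : G.FlatAt (G.src h)) :
    (G.cross (G.inv h) (G.cross h y)).toPoint = y.toPoint := by
  refine Prod.ext (Subtype.ext ?_) rfl
  change G.step (G.inv h, y.2 (G.col (G.inv h))) (G.step (h, y.2 (G.col h)) y.1.1) = _
  rw [G.col_inv]
  exact (G.step_spec y.1.2.1 _ y.1.2.2).2

/-- The identification of the flats at two equal vertices. -/
def flatCongr {i i' : I} (h : i = i') : G.FlatAt i ≃ G.FlatAt i' := h ▸ Equiv.refl _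

lemma toPoint_flatCongr {i i' : I} (h : i = i') (y : G.FlatAt i) :
    (G.flatCongr h y).toPoint = y.toPoint := by
  subst h
  rfl

/-- Crossing hyperplanes along the edges of a rooted spanning tree, in which `e i` is the last edge
on the way from the base vertex to `i`. -/
noncomputable def transport (rk : I → ℕ) (e : ∀ i, i ≠ G.root → H)
    (htgt : ∀ i h, G.tgt (e i h) = i) (hrk : ∀ i h, rk (G.src (e i h)) < rk i) (i : I) :
    G.FlatAt G.root ≃ G.FlatAt i :=
  open Classical in
  if h : i = G.root then G.flatCongr h.symm
  else (transport rk e htgt hrk (G.src (e i h))).trans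
    ((G.cross (e i h)).trans (G.flatCongr (htgt i h)))
termination_by rk i
decreasing_by exact hrk i h

section Transport

variable {G} {rk : I → ℕ} {e : ∀ i, i ≠ G.root → H} {htgt : ∀ i h, G.tgt (e i h) = i}
  {hrk : ∀ i h, rk (G.src (e i h)) < rk i}

lemma transport_root : G.transport rk e htgt hrk G.root = Equiv.refl _ := by
  rw [transport, dif_pos rfl]
  rfl

lemma toPoint_transport {i : I} (hi : i ≠ G.root) (y : G.FlatAt G.root) :
    (G.transport rk e htgt hrk i y).toPoint =
      (G.cross (e i hi) (G.transport rk e htgt hrk (G.src (e i hi)) y)).toPoint := by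
  rw [transport, dif_neg hi]
  exact G.toPoint_flatCongr _ _

lemma edist_transport_le (i : I) (y : G.FlatAt G.root) :
    G.flatGraph.edist y.toPoint (G.transport rk e htgt hrk i y).toPoint ≤ rk i := by
  induction hr : rk i using Nat.strong_induction_on generalizing i with
  | _ r ih =>
    by_cases hi : i = G.root
    · subst hi
      rw [transport_root, Equiv.refl_apply, SimpleGraph.edist_self]
      exact zero_le
    · rw [toPoint_transport hi]
      have := hrk i hi
      exact edist_le_of_le (edist_le_add (ih _ (hr ▸ this) _ rfl) (G.edist_cross_le _ _)) (by omega)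

end Transport

/-- A property of points that is invariant under translations and crossings, and holds at the base
point, holds everywhere. -/
lemma flatAt_induction {Q : ∀ i, G.FlatAt i → Prop} (hbase : Q G.root G.base)
    (htr : ∀ i c y, Q i (G.translate i c y) ↔ Q i y)
    (hcr : ∀ h y, Q (G.src h) y → Q (G.tgt h) (G.cross h y)) (i : I) (y : G.FlatAt i) : Q i y := by
  have h₁ : ∀ i L x (c : Fin m) (k : ℕ), Q i (L, Function.update x c (x c + k)) ↔ Q i (L, x) := by
    intro i L x c k
    induction k with
    | zero => simp
    | succ k ih =>
      rw [← ih, ← htr i c (L, Function.update x c (x c + k))]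
      simp only [translate, Equiv.coe_fn_mk, Function.update_self, Function.update_idem]
      rw [add_assoc]
      rfl
  have h₂ : ∀ i L x (c : Fin m) (k : ℤ), Q i (L, x) → Q i (L, Function.update x c k) := by
    intro i L x c k hq
    rcases le_total (x c) k with h | h
    · have := (h₁ i L x c (k - x c).natAbs).2 hq
      rwa [show x c + ((k - x c).natAbs : ℤ) = k by omega] at this
    · refine (h₁ i L (Function.update x c k) c (k - x c).natAbs).1 ?_
      rwa [Function.update_self, Function.update_idem,
        show k + ((k - x c).natAbs : ℤ) = x c by omega, Function.update_eq_self]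
  have h₃ : ∀ i L (x x' : Fin m → ℤ), Q i (L, x) → Q i (L, x') := by
    intro i L x x' hq
    have key : ∀ s : Finset (Fin m), Q i (L, s.piecewise x' x) := by
      intro s
      induction s using Finset.induction_on with
      | empty => simpa
      | insert c s hc ih =>
        rw [Finset.piecewise_insert]
        exact h₂ _ _ _ _ _ ih
    simpa using key Finset.univ
  obtain ⟨⟨L, hL, rfl⟩, x⟩ := y
  induction L generalizing x with
  | nil => exact h₃ _ _ _ _ hbase
  | cons l L ih =>
    obtain ⟨h, k⟩ := l
    have hs : G.src h = G.endpt L := hL.2.1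
    have key : ∀ (i : I) (hi : G.endpt L = i) (x : Fin m → ℤ), Q i (⟨L, hL.1, hi⟩, x) := by
      intro i hi x
      subst hi
      exact ih x hL.1
    have := hcr h _ (key (G.src h) hs.symm (Function.update x (G.col h) k))
    refine h₃ _ _ (Function.update x (G.col h) k) _ ?_
    have hstep : (h, k) :: L = G.step (h, Function.update x (G.col h) k (G.col h)) L := by
      rw [Function.update_self, G.step_of_extends hL.2]
    have heq : ((⟨(h, k) :: L, hL, rfl⟩, Function.update x (G.col h) k) : G.FlatAt (G.tgt h)) =
        G.cross h (⟨L, hL.1, hs.symm⟩, Function.update x (G.col h) k) :=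
      Prod.ext (Subtype.ext hstep) rfl
    exact heq ▸ this

/-! ### Evaluating paths in a group -/

/-- A labelling of a coloured graph by elements of a group: each vertex carries commuting elements
indexed by the colours, and the label of an edge intertwines those of its two ends, except the one
of its own colour. -/
structure Labelling (A : Type*) [Group A] where
  /-- The commuting elements at a vertex. -/
  t : I → Fin m → A
  /-- The label of an edge. -/
  w : H → A
  comm : ∀ i c d, Commute (t i c) (t i d)
  w_inv : ∀ h, w (G.inv h) = (w h)⁻¹
  t_mul_w : ∀ h c, c ≠ G.col h → t (G.src h) c * w h = w h * t (G.tgt h) c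

namespace Labelling

variable {G} {A : Type*} [Group A] (ℓ : G.Labelling A)

/-- The group element at the origin of the flat of a path. -/
def val : List (H × ℤ) → A
  | [] => 1
  | l :: L => val L * ℓ.t (G.src l.1) (G.col l.1) ^ l.2 * ℓ.w l.1 *
      (ℓ.t (G.tgt l.1) (G.col l.1) ^ l.2)⁻¹

/-- The group element at a point of a flat. -/
def eval (y : G.Path × (Fin m → ℤ)) : A := ℓ.val y.1.1 * monomial (ℓ.t (G.endpt y.1.1)) y.2

lemma eval_update (L : G.Path) (x : Fin m → ℤ) (c : Fin m) (k : ℤ) :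
    ℓ.eval (L, Function.update x c k) = ℓ.eval (L, x) * ℓ.t (G.endpt L.1) c ^ (k - x c) := by
  rw [eval, eval, monomial_update (ℓ.comm _), mul_assoc]

lemma eval_cons {L : List (H × ℤ)} {l : H × ℤ} (hL : G.IsPath (l :: L)) {x : Fin m → ℤ}
    (hx : x (G.col l.1) = l.2) :
    ℓ.eval (⟨l :: L, hL⟩, x) = ℓ.eval (⟨L, hL.1⟩, x) * ℓ.w l.1 := by
  have hs := hL.2.1
  obtain ⟨h, k⟩ := l
  simp only at hx hs
  obtain ⟨x₀, h₀, rfl⟩ : ∃ x₀ : Fin m → ℤ, x₀ (G.col h) = 0 ∧ x = Function.update x₀ (G.col h) k :=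
    ⟨Function.update x (G.col h) 0, by simp, by simp [← hx]⟩
  have hc : ∀ i, monomial (ℓ.t i) (Function.update x₀ (G.col h) k) =
      ℓ.t i (G.col h) ^ k * monomial (ℓ.t i) x₀ := by
    intro i
    rw [monomial_update (ℓ.comm i), h₀, sub_zero]
    exact monomial_mul_comm fun c _ => ((ℓ.comm i c _).zpow_right k).eq
  have hw : monomial (ℓ.t (G.src h)) x₀ * ℓ.w h = ℓ.w h * monomial (ℓ.t (G.tgt h)) x₀ := by
    refine monomial_mul_comm fun c hne => ℓ.t_mul_w h c ?_
    rintro rfl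
    exact hne h₀
  simp only [eval, val]
  rw [← hs]
  change _ * monomial (ℓ.t (G.tgt h)) _ = _
  rw [hc, hc]
  simp only [mul_assoc, hw, inv_mul_cancel_left]

lemma eval_base : ℓ.eval G.base.toPoint = 1 := by
  simp only [eval, FlatAt.toPoint, base, monomial_zero, val, one_mul]

lemma eval_translate (i : I) (c : Fin m) (y : G.FlatAt i) :
    ℓ.eval (G.translate i c y).toPoint = ℓ.eval y.toPoint * ℓ.t i c := by
  obtain ⟨⟨L, hL, rfl⟩, x⟩ := y
  have := ℓ.eval_update ⟨L, hL⟩ x c (x c + 1)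
  rwa [add_sub_cancel_left, zpow_one] at this

lemma eval_cross (h : H) (y : G.FlatAt (G.src h)) :
    ℓ.eval (G.cross h y).toPoint = ℓ.eval y.toPoint * ℓ.w h := by
  obtain ⟨⟨L, hL, hs⟩, x⟩ := y
  rcases G.extends_or_cancel hL (x (G.col h)) hs with he | ⟨L', rfl, hL', he⟩
  · refine Eq.trans ?_ (ℓ.eval_cons (l := (h, x (G.col h))) ⟨hL, he⟩ rfl)
    congr 1
    refine Prod.ext (Subtype.ext (G.step_of_extends he)) rfl
  · have : (G.cross h (⟨_, hL, hs⟩, x)).toPoint = (⟨L', hL'⟩, x) :=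
      Prod.ext (Subtype.ext (G.step_cancel h _ L')) rfl
    rw [this]
    change _ = ℓ.eval (⟨_ :: L', hL⟩, x) * _
    rw [ℓ.eval_cons hL (by simp [G.col_inv]), ℓ.w_inv, inv_mul_cancel_right]

lemma eval_transport {rk : I → ℕ} {e : ∀ i, i ≠ G.root → H} {htgt : ∀ i h, G.tgt (e i h) = i}
    {hrk : ∀ i h, rk (G.src (e i h)) < rk i} (hw : ∀ i h, ℓ.w (e i h) = 1) (i : I)
    (y : G.FlatAt G.root) :
    ℓ.eval (G.transport rk e htgt hrk i y).toPoint = ℓ.eval y.toPoint := by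
  induction hr : rk i using Nat.strong_induction_on generalizing i with
  | _ r ih =>
    by_cases hi : i = G.root
    · subst hi
      rw [transport_root, Equiv.refl_apply]
    · rw [toPoint_transport hi, ℓ.eval_cross, hw, mul_one]
      exact ih _ (hr ▸ hrk i hi) _ rfl

/-- If the label of an edge acts as the crossing of that edge, then so does the label of the
reversed edge. -/
lemma toPoint_apply_inv {γ : ∀ i, G.FlatAt G.root ≃ G.FlatAt i}
    {ρ : A →* (Equiv.Perm (G.FlatAt G.root))ᵐᵒᵖ} {h : H}
    (hw : ∀ y, (γ (G.tgt h) ((ρ (ℓ.w h)).unop y)).toPoint = (G.cross h (γ (G.src h) y)).toPoint)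
    (y : G.FlatAt G.root) :
    (γ (G.tgt (G.inv h)) ((ρ (ℓ.w (G.inv h))).unop y)).toPoint =
      (G.cross (G.inv h) (γ (G.src (G.inv h)) y)).toPoint := by
  obtain ⟨z, rfl⟩ := (ρ (ℓ.w h)).unop.surjective y
  have hz : (ρ (ℓ.w (G.inv h))).unop ((ρ (ℓ.w h)).unop z) = z := by
    rw [← Equiv.Perm.mul_apply, ← MulOpposite.unop_mul, ← map_mul, ℓ.w_inv, mul_inv_cancel]
    simp
  have h₁ : γ (G.src (G.inv h)) ((ρ (ℓ.w h)).unop z) = G.cross h (γ (G.src h) z) :=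
    FlatAt.toPoint_injective (hw z)
  have h₂ : ∀ i i', i = i' → (γ i z).toPoint = (γ i' z).toPoint := by
    rintro i _ rfl
    rfl
  rw [hz, h₁, toPoint_cross_inv_cross, h₂ _ _ (G.tgt_inv h)]

/-- If the group is generated by the labels and acts on the flats at the base vertex in such a way
that, in terms of identifications `γ` of the flats at the various vertices, the labels act as
translations and crossings, then the Cayley graph is coarsely equivalent to the graph of flats. -/
theorem coarselyEquivalent {S : Set A} (hS : Subgroup.closure S = ⊤)
    (γ : ∀ i, G.FlatAt G.root ≃ G.FlatAt i) (N : ℕ) (hroot : γ G.root = Equiv.refl _)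
    (hdist : ∀ i y, G.flatGraph.edist y.toPoint (γ i y).toPoint ≤ N)
    (heval : ∀ i y, ℓ.eval (γ i y).toPoint = ℓ.eval y.toPoint)
    (ρ : A →* (Equiv.Perm (G.FlatAt G.root))ᵐᵒᵖ)
    (ht : ∀ i c y, γ i ((ρ (ℓ.t i c)).unop y) = G.translate i c (γ i y))
    (hw : ∀ h y, (γ (G.tgt h) ((ρ (ℓ.w h)).unop y)).toPoint = (G.cross h (γ (G.src h) y)).toPoint)
    (hS₁ : ∀ s ∈ S, (∃ i c, s = ℓ.t i c) ∨ ∃ h, s = ℓ.w h)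
    (hS₂ : ∀ i c, ℓ.t i c ∈ S)
    (hS₃ : ∀ h, ℓ.w h ∈ S ∨ (ℓ.w h)⁻¹ ∈ S ∨ ℓ.w h = 1) :
    CoarselyEquivalent (mulCayley S) G.flatGraph := by
  replace hw : ∀ h y, γ (G.tgt h) ((ρ (ℓ.w h)).unop y) = G.cross h (γ (G.src h) y) :=
    fun h y => FlatAt.toPoint_injective (hw h y)
  have hγ : ∀ i y, G.flatGraph.edist y.toPoint ((γ i).symm y).toPoint ≤ N := fun i y => by
    rw [edist_comm]
    simpa using hdist i ((γ i).symm y)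
  have hgen : ∀ s ∈ S, ∀ y, G.flatGraph.edist y.toPoint ((ρ s).unop y).toPoint ≤
      ((N + 1 + N : ℕ) : ℕ∞) := by
    intro s hs y
    rcases hS₁ s hs with ⟨i, c, rfl⟩ | ⟨h, rfl⟩
    · rw [← (γ i).symm_apply_apply ((ρ (ℓ.t i c)).unop y), ht]
      exact edist_le_add (edist_le_add (hdist i y) (G.edist_translate_le i c _)) (hγ i _)
    · rw [← (γ (G.tgt h)).symm_apply_apply ((ρ (ℓ.w h)).unop y), hw]
      exact edist_le_add (edist_le_add (hdist _ y) (G.edist_cross_le h _)) (hγ _ _)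
  have hequiv : ∀ (a : A) y, ℓ.eval ((ρ a).unop y).toPoint = ℓ.eval y.toPoint * a := by
    intro a
    have ha : a ∈ Subgroup.closure S := hS ▸ Subgroup.mem_top a
    induction ha using Subgroup.closure_induction with
    | mem s hs =>
      intro y
      rcases hS₁ s hs with ⟨i, c, rfl⟩ | ⟨h, rfl⟩
      · rw [← heval i, ht, ℓ.eval_translate, heval]
      · rw [← heval (G.tgt h), hw, ℓ.eval_cross, heval]
    | one => intro y; simp
    | mul a b _ _ ha hb =>
      intro y
      rw [map_mul, MulOpposite.unop_mul, Equiv.Perm.mul_apply, hb, ha, mul_assoc]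
    | inv a _ ha =>
      intro y
      rw [eq_mul_inv_iff_mul_eq, ← ha, map_inv, MulOpposite.unop_inv, Equiv.Perm.inv_def, Equiv.apply_symm_apply]
  have horbit : ∀ i (y : G.FlatAt i), (ρ (ℓ.eval y.toPoint)).unop G.base = (γ i).symm y := by
    refine G.flatAt_induction ?_ ?_ ?_
    · rw [ℓ.eval_base, hroot]
      simp
    · intro i c y
      rw [ℓ.eval_translate, map_mul, MulOpposite.unop_mul, Equiv.Perm.mul_apply,
        Equiv.eq_symm_apply, ht, EmbeddingLike.apply_eq_iff_eq, Equiv.eq_symm_apply]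
    · intro h y hy
      rw [ℓ.eval_cross, map_mul, MulOpposite.unop_mul, Equiv.Perm.mul_apply,
        Equiv.eq_symm_apply, hw, EmbeddingLike.apply_eq_iff_eq, hy, Equiv.apply_symm_apply]
  refine ⟨fun a => ((ρ a).unop G.base).toPoint, ℓ.eval, N + 1 + N, ?_, ?_, ?_, ?_⟩
  · intro a b hab
    refine edist_le_of_adj_fromRel (f := fun a => ((ρ a).unop G.base).toPoint) ?_ hab
    rintro a _ ⟨s, hs, rfl⟩
    rw [map_mul, MulOpposite.unop_mul, Equiv.Perm.mul_apply]
    exact hgen s hs _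
  · intro y y' hy
    refine edist_le_of_adj_fromRel (f := ℓ.eval) ?_ hy
    refine fun y y' h => edist_le_of_le (b := N + 1 + N) (a := 1) ?_ (by omega)
    obtain ⟨L, x⟩ := y
    obtain ⟨⟨L', hL'⟩, x'⟩ := y'
    rcases h with ⟨hp, c, hx⟩ | ⟨hx, c, h, rfl, hr⟩
    · simp only at hp hx
      subst hp hx
      rw [ℓ.eval_update, add_sub_cancel_left, zpow_one]
      exact edist_mulCayley_mul_le_one (Or.inl (hS₂ _ _))
    · simp only at hx hr
      subst hx hr
      rw [ℓ.eval_cons hL' rfl]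
      exact edist_mulCayley_mul_le_one (hS₃ h)
  · intro a
    rw [hequiv, ℓ.eval_base, one_mul, SimpleGraph.edist_self]
    exact zero_le
  · rintro ⟨⟨L, hL⟩, x⟩
    have := horbit _ ((⟨L, hL, rfl⟩, x) : G.FlatAt (G.endpt L))
    change G.flatGraph.edist ((ρ (ℓ.eval (⟨L, hL⟩, x))).unop G.base).toPoint _ ≤ _
    change (ρ (ℓ.eval (⟨L, hL⟩, x))).unop G.base = _ at this
    rw [this]
    rw [edist_comm]
    exact edist_le_of_le (a := N) (hγ _ ((⟨L, hL, rfl⟩, x) : G.FlatAt (G.endpt L))) (by omega)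

end Labelling

end ColoredGraph

/-! ### Building up a tree of simplices one simplex at a time -/

namespace NTree

variable {V : Type*}

/-- The complex `K` is the union of the simplices `S 0, …, S N`, where `S j`, for `j > 0`, consists
of an apex `v j` that lies in no earlier simplex, and of points of a single earlier simplex. -/
structure IsBuildUp (n : ℕ) (K : PreAbstractSimplicialComplex V) (N : ℕ) (S : ℕ → Finset V)
    (v : ℕ → V) : Prop where
  mem_faces : ∀ t, t ∈ K.faces ↔ t.Nonempty ∧ ∃ j ≤ N, t ⊆ S j
  card : ∀ j ≤ N, (S j).card = n + 1
  apex_mem : ∀ j, 1 ≤ j → j ≤ N → v j ∈ S j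
  apex_notMem : ∀ j k, k < j → j ≤ N → v j ∉ S k
  exists_parent : ∀ j, 1 ≤ j → j ≤ N → ∃ k < j, ∀ u ∈ S j, u ≠ v j → u ∈ S k

lemma IsTreeComplex.exists_facet {n : ℕ} {K : PreAbstractSimplicialComplex V}
    (hK : IsTreeComplex n K) : ∃ s ∈ K.faces, s.card = n + 1 := by
  induction hK with
  | simplex s hs =>
    exact ⟨s, ⟨Finset.card_pos.1 (by omega), Finset.Subset.refl s⟩, hs⟩
  | union K₁ K₂ σ _ _ _ _ ih₁ _ =>
    obtain ⟨s, hs, hc⟩ := ih₁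
    exact ⟨s, Or.inl hs, hc⟩

/-- Two build-ups of complexes that meet in a simplex of dimension one less can be concatenated,
provided that the second can be started anywhere. -/
lemma IsBuildUp.union {n : ℕ} {K₁ K₂ : PreAbstractSimplicialComplex V} {σ : Finset V}
    (hσ : σ.card = n) (hinter : K₁ ⊓ K₂ = NTree.simplex σ) {N₁ : ℕ} {S₁ : ℕ → Finset V}
    {v₁ : ℕ → V} (h₁ : IsBuildUp n K₁ N₁ S₁ v₁) (hne : ∃ s ∈ K₂.faces, s.card = n + 1)
    (h₂ : ∀ s ∈ K₂.faces, s.card = n + 1 → ∃ N S v, IsBuildUp n K₂ N S v ∧ S 0 = s) :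
    ∃ N S v, IsBuildUp n (K₁ ⊔ K₂) N S v ∧ S 0 = S₁ 0 := by
  classical
  have hint : ∀ t : Finset V, t ∈ K₁.faces → t ∈ K₂.faces → t ⊆ σ := by
    intro t ht₁ ht₂
    have : t ∈ (K₁ ⊓ K₂).faces := ⟨ht₁, ht₂⟩
    rw [hinter] at this
    exact this.2
  have hσ' : σ.Nonempty → σ ∈ K₁.faces ∧ σ ∈ K₂.faces := by
    intro hne
    have : σ ∈ (K₁ ⊓ K₂).faces := by
      rw [hinter]
      exact ⟨hne, Finset.Subset.refl σ⟩
    exact this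
  have sub : ∀ {K : PreAbstractSimplicialComplex V} {N S v}, IsBuildUp n K N S v →
      (σ.Nonempty → σ ∈ K.faces) → ∃ k ≤ N, σ ⊆ S k := by
    intro K N S v h hK
    rcases σ.eq_empty_or_nonempty with rfl | hne
    · exact ⟨0, Nat.zero_le _, Finset.empty_subset _⟩
    · exact ((h.mem_faces σ).1 (hK hne)).2
  obtain ⟨k₁, hk₁, hσ₁⟩ := sub h₁ fun h => (hσ' h).1
  obtain ⟨s, hs, hsc⟩ := hne
  obtain ⟨N', S', v', h', -⟩ := h₂ s hs hsc
  obtain ⟨k', hk', hσ'⟩ := sub h' fun h => (hσ' h).2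
  have hcard' := h'.card k' hk'
  obtain ⟨N₂, S₂, v₂, h₂, h0⟩ := h₂ (S' k')
    ((h'.mem_faces _).2 ⟨Finset.card_pos.1 (by omega), k', hk', Finset.Subset.refl _⟩) hcard'
  rw [← h0] at hσ' hcard'
  obtain ⟨a, ha⟩ : ∃ a, S₂ 0 \ σ = {a} := by
    rw [← Finset.card_eq_one, Finset.card_sdiff_of_subset hσ']
    omega
  have ha' : ∀ u, u ∈ S₂ 0 ∧ u ∉ σ ↔ u = a := fun u => by
    rw [← Finset.mem_sdiff, ha, Finset.mem_singleton]
  have hdisj : ∀ k l u, k ≤ N₁ → l ≤ N₂ → u ∈ S₁ k → u ∈ S₂ l → u ∈ σ := by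
    intro k l u hk hl hu₁ hu₂
    refine hint {u} ((h₁.mem_faces _).2 ⟨by simp, k, hk, by simpa⟩)
      ((h₂.mem_faces _).2 ⟨by simp, l, hl, by simpa⟩) (Finset.mem_singleton_self u)
  refine ⟨N₁ + 1 + N₂, fun j => if j ≤ N₁ then S₁ j else S₂ (j - (N₁ + 1)),
    fun j => if j ≤ N₁ then v₁ j else if j = N₁ + 1 then a else v₂ (j - (N₁ + 1)),
    ⟨?_, ?_, ?_, ?_, ?_⟩, by simp⟩
  · intro t
    change t ∈ K₁.faces ∨ t ∈ K₂.faces ↔ _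
    rw [h₁.mem_faces, h₂.mem_faces, ← and_or_left]
    refine and_congr_right fun _ => ⟨?_, ?_⟩
    · rintro (⟨j, hj, hjt⟩ | ⟨j, hj, hjt⟩)
      · exact ⟨j, by omega, by rwa [if_pos hj]⟩
      · refine ⟨j + (N₁ + 1), by omega, ?_⟩
        rwa [if_neg (by omega), Nat.add_sub_cancel]
    · rintro ⟨j, hj, hjt⟩
      split_ifs at hjt with hj'
      · exact Or.inl ⟨j, hj', hjt⟩
      · exact Or.inr ⟨_, by omega, hjt⟩
  · intro j hj
    split_ifs with hj'
    · exact h₁.card j hj'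
    · exact h₂.card _ (by omega)
  · intro j hj₁ hj
    split_ifs with hj' hj''
    · exact h₁.apex_mem j hj₁ hj'
    · rw [hj'', Nat.sub_self]
      exact ((ha' a).2 rfl).1
    · exact h₂.apex_mem _ (by omega) (by omega)
  · intro j k hkj hj
    by_cases hj' : j ≤ N₁
    · rw [if_pos hj', if_pos (by omega)]
      exact h₁.apex_notMem j k hkj hj'
    · rw [if_neg hj']
      by_cases hj'' : j = N₁ + 1
      · rw [if_pos hj'', if_pos (by omega)]
        intro hak
        exact ((ha' a).2 rfl).2 (hdisj k 0 a (by omega) (by omega) hak ((ha' a).2 rfl).1)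
      · rw [if_neg hj'']
        split_ifs with hk
        · intro hvk
          have := hdisj k (j - (N₁ + 1)) _ hk (by omega) hvk (h₂.apex_mem _ (by omega) (by omega))
          exact h₂.apex_notMem (j - (N₁ + 1)) 0 (by omega) (by omega) (hσ' this)
        · exact h₂.apex_notMem _ _ (by omega) (by omega)
  · intro j hj₁ hj
    by_cases hj' : j ≤ N₁
    · obtain ⟨k, hk, hks⟩ := h₁.exists_parent j hj₁ hj'
      refine ⟨k, hk, ?_⟩
      rwa [if_pos hj', if_pos hj', if_pos (by omega)]
    · rw [if_neg hj', if_neg hj']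
      by_cases hj'' : j = N₁ + 1
      · refine ⟨k₁, by omega, fun u hu hua => ?_⟩
        rw [if_pos hj''] at hua
        rw [if_pos hk₁]
        rw [hj'', Nat.sub_self] at hu
        exact hσ₁ (by_contra fun h => hua ((ha' u).1 ⟨hu, h⟩))
      · obtain ⟨k, hk, hks⟩ := h₂.exists_parent (j - (N₁ + 1)) (by omega) (by omega)
        refine ⟨k + (N₁ + 1), by omega, ?_⟩
        rwa [if_neg hj'', if_neg (by omega), Nat.add_sub_cancel]

/-- A complex in `𝒯ₙ` can be built up starting from any of its `n`-simplices. -/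
theorem IsTreeComplex.exists_isBuildUp {n : ℕ} {K : PreAbstractSimplicialComplex V}
    (hK : IsTreeComplex n K) :
    ∀ s ∈ K.faces, s.card = n + 1 → ∃ N S v, IsBuildUp n K N S v ∧ S 0 = s := by
  induction hK with
  | simplex s hs =>
    rintro t ⟨⟨a, -⟩, hts⟩ htc
    obtain rfl := Finset.eq_of_subset_of_card_le hts (by omega)
    exact ⟨0, fun _ => t, fun _ => a,
      ⟨fun t' => ⟨fun h => ⟨h.1, 0, le_rfl, h.2⟩, fun h => ⟨h.1, h.2.choose_spec.2⟩⟩,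
        fun _ _ => hs, by omega, by omega, by omega⟩, rfl⟩
  | union K₁ K₂ σ h₁ h₂ hσ hinter ih₁ ih₂ =>
    rintro s (hs | hs) hsc
    · obtain ⟨N, S, v, h, rfl⟩ := ih₁ s hs hsc
      exact h.union hσ hinter h₂.exists_facet ih₂
    · obtain ⟨N, S, v, h, rfl⟩ := ih₂ s hs hsc
      rw [sup_comm]
      exact h.union hσ (by rw [inf_comm, hinter]) h₁.exists_facet ih₁

/-- Other `n`-simplices are glued to `s` along all of its `(n-1)`-faces. -/
def IsInner (n : ℕ) (K : PreAbstractSimplicialComplex V) (s : Finset V) : Prop :=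
  ∀ t : Finset V, t ⊆ s → t.card = n → IsGluedAlong n K s t

namespace IsBuildUp

variable {n : ℕ} {K : PreAbstractSimplicialComplex V} {N : ℕ} {S : ℕ → Finset V} {v : ℕ → V}

lemma mem_of_le (h : IsBuildUp n K N S v) {j : ℕ} (hj : j ≤ N) : S j ∈ K.faces :=
  (h.mem_faces _).2 ⟨Finset.card_pos.1 (by have := h.card j hj; omega), j, hj, Finset.Subset.refl _⟩

lemma injective (h : IsBuildUp n K N S v) {j k : ℕ} (hj : j ≤ N) (hk : k ≤ N) (hjk : j ≠ k) :
    S j ≠ S k := by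
  intro he
  rcases lt_or_gt_of_ne hjk with hlt | hlt
  · exact h.apex_notMem k j hlt hk (he ▸ h.apex_mem k (by omega) hk)
  · exact h.apex_notMem j k hlt hj (he ▸ h.apex_mem j (by omega) hj)

lemma isGluedAlong (h : IsBuildUp n K N S v) {j k : ℕ} (hj : j ≤ N) (hk : k ≤ N) (hjk : j ≠ k)
    {t : Finset V} (ht : t ⊆ S k) : IsGluedAlong n K (S j) t :=
  ⟨S k, h.mem_of_le hk, h.card k hk, h.injective hk hj hjk.symm, ht⟩

lemma exists_of_isGluedAlong (h : IsBuildUp n K N S v) {j : ℕ} {t : Finset V}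
    (ht : IsGluedAlong n K (S j) t) : ∃ k ≤ N, k ≠ j ∧ t ⊆ S k := by
  obtain ⟨s, hs, hsc, hne, hts⟩ := ht
  obtain ⟨-, k, hk, hsk⟩ := (h.mem_faces s).1 hs
  obtain rfl := Finset.eq_of_subset_of_card_le hsk (by rw [h.card k hk]; omega)
  exact ⟨k, hk, fun he => hne (he ▸ rfl), hts⟩

/-- The index of the first simplex that contains all points of `S j` except the apex. -/
noncomputable def _root_.NTree.parent (S : ℕ → Finset V) (v : ℕ → V) (j : ℕ) : ℕ :=
  sInf {k | ∀ u ∈ S j, u ≠ v j → u ∈ S k}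

lemma mem_parent (h : IsBuildUp n K N S v) {j : ℕ} (hj₁ : 1 ≤ j) (hj : j ≤ N) {u : V}
    (hu : u ∈ S j) (hne : u ≠ v j) : u ∈ S (parent S v j) := by
  obtain ⟨k, -, hk⟩ := h.exists_parent j hj₁ hj
  exact Nat.sInf_mem (s := {k | ∀ u ∈ S j, u ≠ v j → u ∈ S k}) ⟨k, hk⟩ u hu hne

lemma parent_le (j k : ℕ) (hk : ∀ u ∈ S j, u ≠ v j → u ∈ S k) : parent S v j ≤ k :=
  Nat.sInf_le hk

lemma parent_lt (h : IsBuildUp n K N S v) {j : ℕ} (hj₁ : 1 ≤ j) (hj : j ≤ N) :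
    parent S v j < j := by
  obtain ⟨k, hkj, hk⟩ := h.exists_parent j hj₁ hj
  exact (parent_le j k hk).trans_lt hkj

section Erase

variable [DecidableEq V]

lemma card_erase (h : IsBuildUp n K N S v) {j : ℕ} (hj₁ : 1 ≤ j) (hj : j ≤ N) :
    ((S j).erase (v j)).card = n := by
  rw [Finset.card_erase_of_mem (h.apex_mem j hj₁ hj), h.card j hj, Nat.add_sub_cancel]

lemma erase_subset_parent (h : IsBuildUp n K N S v) {j : ℕ} (hj₁ : 1 ≤ j) (hj : j ≤ N) :
    (S j).erase (v j) ⊆ S (parent S v j) := fun _ hu =>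
  h.mem_parent hj₁ hj (Finset.mem_of_mem_erase hu) (Finset.ne_of_mem_erase hu)

end Erase

/-- In a maximally branched complex, a simplex other than the first one that is the parent of some
simplex is glued along two distinct faces, hence along all faces. -/
lemma parent_eq_zero_or_isInner (h : IsBuildUp n K N S v) (hmax : IsMaximallyBranched n K) {j : ℕ}
    (hj₁ : 1 ≤ j) (hj : j ≤ N) : parent S v j = 0 ∨ IsInner n K (S (parent S v j)) := by
  classical
  have hlt := h.parent_lt hj₁ hj
  set k := parent S v j with hk
  rcases Nat.eq_zero_or_pos k with h0 | hk₁
  · exact Or.inl h0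
  right
  refine (hmax (S k) (h.mem_of_le (by omega)) (h.card k (by omega))).resolve_left ?_
  rintro ⟨t, -, huniq⟩
  have e₁ := huniq ((S k).erase (v k)) ⟨⟨Finset.erase_subset _ _, h.card_erase hk₁ (by omega)⟩,
    h.isGluedAlong (by omega) (by have := h.parent_lt hk₁ (by omega); omega)
      (h.parent_lt hk₁ (by omega)).ne' (h.erase_subset_parent hk₁ (by omega))⟩
  have e₂ := huniq ((S j).erase (v j)) ⟨⟨h.erase_subset_parent hj₁ hj, h.card_erase hj₁ hj⟩,
    h.isGluedAlong (by omega) hj hlt.ne (Finset.erase_subset _ _)⟩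
  have := parent_le (S := S) (v := v) j (parent S v k) fun u hu hne =>
    h.erase_subset_parent hk₁ (by omega) (by
      rw [e₁, ← e₂]
      exact Finset.mem_erase.2 ⟨hne, hu⟩)
  have := h.parent_lt hk₁ (by omega)
  omega

lemma isReducible (h : IsBuildUp n K N S v) {u : V} (hu : ∀ j ≤ N, u ∈ S j) : IsReducible K := by
  classical
  refine ⟨⟨u, (h.mem_faces _).2 ⟨by simp, 0, Nat.zero_le _, by simpa using hu 0 (Nat.zero_le _)⟩⟩,
    fun w hw => ⟨hw.symm, ?_⟩⟩
  obtain ⟨-, j, hj, hwj⟩ := (h.mem_faces _).1 w.2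
  refine ⟨{u, w.1}, (h.mem_faces _).2 ⟨by simp, j, hj, ?_⟩, by simp⟩
  rw [Finset.singleton_subset_iff] at hwj
  simp [Finset.insert_subset_iff, hu j hj, hwj]

end IsBuildUp

/-- In an irreducible maximally branched complex some simplex is glued along all of its faces: if
not, all simplices are glued along the same face. -/
lemma IsTreeComplex.exists_isInner {n : ℕ} {K : PreAbstractSimplicialComplex V}
    (hK : IsTreeComplex n K) (hirr : ¬ IsReducible K) (hmax : IsMaximallyBranched n K) :
    ∃ s ∈ K.faces, s.card = n + 1 ∧ IsInner n K s := by
  classical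
  by_contra! hno
  obtain ⟨s, hs, hsc⟩ := hK.exists_facet
  obtain ⟨N, S, v, h, rfl⟩ := hK.exists_isBuildUp s hs hsc
  have hno' : ∀ j ≤ N, ¬ IsInner n K (S j) := fun j hj => hno _ (h.mem_of_le hj) (h.card j hj)
  rcases Nat.eq_zero_or_pos N with rfl | hN
  · obtain ⟨u, hu⟩ : (S 0).Nonempty := Finset.card_pos.1 (by omega)
    exact hirr (h.isReducible (u := u) fun j hj => by rwa [Nat.le_zero.1 hj])
  rcases Nat.eq_zero_or_pos n with rfl | hn
  · refine hno' 0 (Nat.zero_le _) fun t _ ht => ?_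
    rw [Finset.card_eq_zero] at ht
    exact h.isGluedAlong (Nat.zero_le _) hN (by omega) (ht ▸ Finset.empty_subset _)
  obtain ⟨u, hu⟩ : ((S 1).erase (v 1)).Nonempty :=
    Finset.card_pos.1 (by rw [h.card_erase le_rfl hN]; omega)
  have hpar : ∀ j, 1 ≤ j → j ≤ N → (S j).erase (v j) ⊆ S 0 := by
    intro j hj₁ hj
    have := h.erase_subset_parent hj₁ hj
    rwa [(h.parent_eq_zero_or_isInner hmax hj₁ hj).resolve_right
      (hno' _ (by have := h.parent_lt hj₁ hj; omega))] at this
  obtain ⟨t, -, huniq⟩ := (hmax (S 0) hs hsc).resolve_right (hno' 0 (Nat.zero_le _))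
  have huniq' : ∀ j, 1 ≤ j → j ≤ N → (S j).erase (v j) = t := fun j hj₁ hj =>
    huniq _ ⟨⟨hpar j hj₁ hj, h.card_erase hj₁ hj⟩,
      h.isGluedAlong (Nat.zero_le _) hj (by omega) (Finset.erase_subset _ _)⟩
  refine hirr (h.isReducible (u := u) fun j hj => ?_)
  rcases Nat.eq_zero_or_pos j with rfl | hj₁
  · exact hpar 1 le_rfl hN hu
  · rw [huniq' 1 le_rfl hN, ← huniq' j hj₁ hj] at hu
    exact Finset.mem_of_mem_erase hu

namespace IsBuildUp

variable {n : ℕ} {K : PreAbstractSimplicialComplex V} {N : ℕ} {S : ℕ → Finset V} {v : ℕ → V}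

/-- The vertices can be coloured with `n + 1` colours such that those of each simplex have distinct
colours. -/
lemma exists_coloring (h : IsBuildUp n K N S v) :
    ∃ col : V → Fin (n + 1), ∀ j ≤ N, Set.InjOn col (S j) := by
  classical
  have key : ∀ M ≤ N, ∃ col : V → Fin (n + 1), ∀ j ≤ M, Set.InjOn col (S j) := by
    intro M hM
    induction M with
    | zero =>
      let e := Finset.equivFinOfCardEq (h.card 0 hM)
      refine ⟨fun u => if hu : u ∈ S 0 then e ⟨u, hu⟩ else 0, fun j hj a ha b hb hab => ?_⟩
      rw [Nat.le_zero.1 hj] at ha hb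
      simp only [Finset.mem_coe] at ha hb
      simp only [dif_pos ha, dif_pos hb] at hab
      simpa using hab
    | succ M ih =>
      obtain ⟨col, hcol⟩ := ih (by omega)
      obtain ⟨c, hc⟩ : ∃ c, c ∉ ((S (M + 1)).erase (v (M + 1))).image col := by
        by_contra! hall
        have h₁ := Finset.card_le_card (fun c _ => hall c :
          (Finset.univ : Finset (Fin (n + 1))) ⊆ _)
        have h₂ := Finset.card_image_le (s := (S (M + 1)).erase (v (M + 1))) (f := col)
        rw [h.card_erase (by omega) hM] at h₂
        rw [Finset.card_univ, Fintype.card_fin] at h₁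
        omega
      have hc' : ∀ u ∈ S (M + 1), u ≠ v (M + 1) → col u ≠ c := fun u hu hne he =>
        hc (Finset.mem_image.2 ⟨u, Finset.mem_erase.2 ⟨hne, hu⟩, he⟩)
      refine ⟨Function.update col (v (M + 1)) c, fun j hj a ha b hb hab => ?_⟩
      rcases Nat.lt_or_ge M j with hj' | hj'
      · obtain rfl : j = M + 1 := by omega
        by_cases hav : a = v (M + 1) <;> by_cases hbv : b = v (M + 1)
        · rw [hav, hbv]
        · rw [hav, Function.update_self, Function.update_of_ne hbv] at hab
          exact absurd hab.symm (hc' b hb hbv)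
        · rw [hbv, Function.update_self, Function.update_of_ne hav] at hab
          exact absurd hab (hc' a ha hav)
        · rw [Function.update_of_ne hav, Function.update_of_ne hbv] at hab
          have hlt := h.parent_lt (j := M + 1) (by omega) hM
          exact hcol _ (by omega) (h.mem_parent (by omega) hM ha hav)
            (h.mem_parent (by omega) hM hb hbv) hab
      · have hn : ∀ w ∈ S j, w ≠ v (M + 1) := by
          rintro w hw rfl
          exact h.apex_notMem (M + 1) j (by omega) hM hw
        rw [Function.update_of_ne (hn a ha), Function.update_of_ne (hn b hb)] at hab
        exact hcol j hj' ha hb hab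
  exact key N le_rfl

lemma exists_mem_col (h : IsBuildUp n K N S v) {col : V → Fin (n + 1)}
    (hcol : ∀ j ≤ N, Set.InjOn col (S j)) {j : ℕ} (hj : j ≤ N) (c : Fin (n + 1)) :
    ∃ u ∈ S j, col u = c := by
  classical
  have : (S j).image col = Finset.univ := by
    rw [← Finset.card_eq_iff_eq_univ, Finset.card_image_of_injOn (hcol j hj), h.card j hj,
      Fintype.card_fin]
  have hc := Finset.mem_univ c
  rw [← this] at hc
  exact Finset.mem_image.1 hc

/-- Of each colour there is a simplex attached to an inner simplex, or the inner simplex itself is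
attached to its parent along the face opposite to the vertex of that colour. -/
lemma exists_edge_of_isInner (h : IsBuildUp n K N S v) {col : V → Fin (n + 1)}
    (hcol : ∀ j ≤ N, Set.InjOn col (S j)) {j : ℕ} (hj : j ≤ N) (hin : IsInner n K (S j))
    (c : Fin (n + 1)) : (1 ≤ j ∧ col (v j) = c) ∨
      ∃ k, 1 ≤ k ∧ k ≤ N ∧ parent S v k = j ∧ col (v k) = c := by
  classical
  obtain ⟨a, ha, hac⟩ := h.exists_mem_col hcol hj c
  have htc : ((S j).erase a).card = n := by
    rw [Finset.card_erase_of_mem ha, h.card j hj, Nat.add_sub_cancel]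
  -- a simplex that shares the face with an earlier one is attached along it
  have key : ∀ k i, k ≤ N → i < k → (S j).erase a ⊆ S k → (S j).erase a ⊆ S i →
      1 ≤ k ∧ (S j).erase a = (S k).erase (v k) := by
    intro k i hk hik hsk hsi
    refine ⟨by omega, Finset.eq_of_subset_of_card_le (fun u hu => Finset.mem_erase.2 ⟨?_, hsk hu⟩)
      (by rw [h.card_erase (by omega) hk, htc])⟩
    rintro rfl
    exact h.apex_notMem k i hik hk (hsi hu)
  by_cases hfirst : ∃ i < j, (S j).erase a ⊆ S i
  · obtain ⟨i, hi, hsi⟩ := hfirst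
    obtain ⟨hj₁, he⟩ := key j i hj hi (Finset.erase_subset _ _) hsi
    refine Or.inl ⟨hj₁, ?_⟩
    rw [← hac]
    by_contra hne
    have hv : v j ∈ (S j).erase a :=
      Finset.mem_erase.2 ⟨fun hva => hne (by rw [hva]), h.apex_mem j hj₁ hj⟩
    rw [he] at hv
    simp at hv
  · push Not at hfirst
    obtain ⟨k, hk, hkj, hsk⟩ := h.exists_of_isGluedAlong
      (hin _ (Finset.erase_subset _ _) htc)
    have hjk : j < k := by
      rcases lt_or_gt_of_ne hkj with hlt | hlt
      · exact absurd hsk (hfirst k hlt)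
      · exact hlt
    obtain ⟨hk₁, he⟩ := key k j hk hjk hsk (Finset.erase_subset _ _)
    have hpar : parent S v k = j := by
      refine le_antisymm (parent_le k j fun u hu hne => ?_) ?_
      · exact Finset.mem_of_mem_erase (he ▸ Finset.mem_erase.2 ⟨hne, hu⟩)
      · by_contra! hlt
        exact hfirst _ hlt (he ▸ h.erase_subset_parent hk₁ hk)
    refine Or.inr ⟨k, hk₁, hk, hpar, ?_⟩
    -- the vertex of colour `c` in `S k` is not in the common face
    obtain ⟨b, hb, hbc⟩ := h.exists_mem_col hcol hk c
    by_cases hbv : b = v k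
    · rw [← hbv, hbc]
    · have hbj : b ∈ (S j).erase a := he ▸ Finset.mem_erase.2 ⟨hbv, hb⟩
      exact absurd (hcol j hj (Finset.mem_of_mem_erase hbj) ha (hbc.trans hac.symm))
        (Finset.ne_of_mem_erase hbj)

end IsBuildUp

end NTree

/-! ### The coloured graph of a maximally branched complex -/

namespace NTree

variable {V : Type*}

/-- The vertex of `K` given by a point. -/
def mkVertex {K : PreAbstractSimplicialComplex V} {u : V} (hu : {u} ∈ K.faces) : Vertex K := ⟨u, hu⟩

/-- The generator of the Artin group given by a point, or `1` if the point is not a vertex. -/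
noncomputable def gen (K : PreAbstractSimplicialComplex V) (u : V) : artinGroup K :=
  open Classical in
  if hu : {u} ∈ K.faces then PresentedGroup.of (mkVertex hu) else 1

/-- A colouring and a build-up of a maximally branched complex that starts with an inner simplex. -/
structure Branching (n : ℕ) (K : PreAbstractSimplicialComplex V) where
  /-- The number of steps. -/
  N : ℕ
  /-- The simplices. -/
  S : ℕ → Finset V
  /-- The apices. -/
  v : ℕ → V
  /-- The colouring. -/
  col : V → Fin (n + 1)
  isBuildUp : IsBuildUp n K N S v
  injOn_col : ∀ j ≤ N, Set.InjOn col (S j)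
  isInner_zero : IsInner n K (S 0)
  isMaximallyBranched : IsMaximallyBranched n K

theorem IsTreeComplex.nonempty_branching {n : ℕ} {K : PreAbstractSimplicialComplex V}
    (hK : IsTreeComplex n K) (hirr : ¬ IsReducible K) (hmax : IsMaximallyBranched n K) :
    Nonempty (Branching n K) := by
  obtain ⟨s, hs, hsc, hin⟩ := hK.exists_isInner hirr hmax
  obtain ⟨N, S, v, h, rfl⟩ := hK.exists_isBuildUp s hs hsc
  obtain ⟨col, hcol⟩ := h.exists_coloring
  exact ⟨⟨N, S, v, col, h, hcol, hin, hmax⟩⟩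

namespace Branching

variable {n : ℕ} {K : PreAbstractSimplicialComplex V} (B : Branching n K)

/-- The indices of the inner simplices. -/
abbrev Inner : Type := {j : ℕ // j ≤ B.N ∧ IsInner n K (B.S j)}

/-- The parent of the simplex with index `i + 1`. -/
noncomputable def par (i : Fin B.N) : B.Inner :=
  ⟨parent B.S B.v (i + 1), by
    have := B.isBuildUp.parent_lt (j := i + 1) (by omega) (by omega)
    omega, by
    rcases B.isBuildUp.parent_eq_zero_or_isInner B.isMaximallyBranched (j := i + 1) (by omega)
      (by omega) with h | h
    · rw [h]
      exact B.isInner_zero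
    · exact h⟩

open Classical in
/-- The simplex with index `i + 1` if that is inner, and its parent otherwise. -/
noncomputable def top (i : Fin B.N) : B.Inner :=
  if h : IsInner n K (B.S (i + 1)) then ⟨i + 1, by omega, h⟩ else B.par i

/-- The graph with the inner simplices as vertices that has an edge for each simplex except the
first one: an inner simplex is joined to its parent, and any other simplex gives a loop at its
parent. The colour of an edge is that of the apex of the simplex. -/
noncomputable def graph : ColoredGraph (n + 1) B.Inner (Fin B.N × Bool) where
  src h := if h.2 then B.par h.1 else B.top h.1
  inv h := (h.1, !h.2)
  inv_inv h := by simp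
  col h := B.col (B.v (h.1 + 1))
  col_inv h := rfl
  root := ⟨0, Nat.zero_le _, B.isInner_zero⟩

/-- Each vertex of the graph is the start of an edge of each colour, because all faces of an inner
simplex are glued to other simplices. -/
lemma exists_src_eq (i : B.Inner) (c : Fin (n + 1)) :
    ∃ h, B.graph.src h = i ∧ B.graph.col h = c := by
  obtain ⟨j, hj, hin⟩ := i
  rcases B.isBuildUp.exists_edge_of_isInner B.injOn_col hj hin c with
    ⟨hj₁, hc⟩ | ⟨k, hk₁, hk, hpar, hc⟩
  · obtain ⟨j, rfl⟩ : ∃ i, j = i + 1 := ⟨j - 1, by omega⟩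
    refine ⟨(⟨j, by omega⟩, false), ?_, hc⟩
    change B.top _ = _
    simp only [top]
    rw [dif_pos hin]
  · obtain ⟨k, rfl⟩ : ∃ i, k = i + 1 := ⟨k - 1, by omega⟩
    exact ⟨(⟨k, by omega⟩, true), Subtype.ext hpar, hc⟩

/-- The vertex of a given colour of an inner simplex. -/
noncomputable def vert (j : B.Inner) (c : Fin (n + 1)) : V :=
  (B.isBuildUp.exists_mem_col B.injOn_col j.2.1 c).choose

lemma vert_mem (j : B.Inner) (c : Fin (n + 1)) : B.vert j c ∈ B.S j :=
  (B.isBuildUp.exists_mem_col B.injOn_col j.2.1 c).choose_spec.1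

lemma col_vert (j : B.Inner) (c : Fin (n + 1)) : B.col (B.vert j c) = c :=
  (B.isBuildUp.exists_mem_col B.injOn_col j.2.1 c).choose_spec.2

lemma vert_col {j : B.Inner} {u : V} (hu : u ∈ B.S j) : B.vert j (B.col u) = u :=
  B.injOn_col _ j.2.1 (B.vert_mem _ _) hu (B.col_vert _ _)

lemma singleton_mem {j : ℕ} (hj : j ≤ B.N) {u : V} (hu : u ∈ B.S j) : {u} ∈ K.faces :=
  (B.isBuildUp.mem_faces _).2 ⟨by simp, j, hj, by simpa⟩

lemma gen_eq {u : V} (hu : {u} ∈ K.faces) :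
    gen K u = PresentedGroup.of (mkVertex hu) := dif_pos hu

lemma commute_gen {j : ℕ} (hj : j ≤ B.N) {u u' : V} (hu : u ∈ B.S j) (hu' : u' ∈ B.S j) :
    Commute (gen K u) (gen K u') := by
  classical
  by_cases he : u = u'
  · rw [he]
  rw [gen_eq (B.singleton_mem hj hu), gen_eq (B.singleton_mem hj hu')]
  have hadj : (oneSkeleton K).Adj (mkVertex (B.singleton_mem hj hu))
      (mkVertex (B.singleton_mem hj hu')) := by
    refine ⟨fun h => he (congrArg Subtype.val h), {u, u'}, (B.isBuildUp.mem_faces _).2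
      ⟨by simp, j, hj, ?_⟩, by simp [mkVertex]⟩
    simp [Finset.insert_subset_iff, hu, hu']
  have := PresentedGroup.one_of_mem
    (rels := {r | ∃ u v, (oneSkeleton K).Adj u v ∧ r = FreeGroup.of u * FreeGroup.of v *
      (FreeGroup.of u)⁻¹ * (FreeGroup.of v)⁻¹}) ⟨_, _, hadj, rfl⟩
  simp only [map_mul, map_inv] at this
  rw [mul_inv_eq_one, mul_inv_eq_iff_eq_mul] at this
  exact this

lemma vert_par_mem (i : Fin B.N) {c : Fin (n + 1)} (hc : c ≠ B.col (B.v (i + 1))) :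
    B.vert (B.par i) c ∈ B.S (i + 1) := by
  obtain ⟨u, hu, rfl⟩ := B.isBuildUp.exists_mem_col B.injOn_col (j := i + 1) (by omega) c
  rwa [B.vert_col (j := B.par i) (B.isBuildUp.mem_parent (by omega) (by omega) hu
    fun he => hc (by rw [he]))]

open Classical in
/-- The label of the edge of the simplex with index `i + 1`, oriented away from the parent. -/
noncomputable def label (i : Fin B.N) : artinGroup K :=
  if IsInner n K (B.S (i + 1)) then 1 else gen K (B.v (i + 1))

lemma gen_vert_mul_label (i : Fin B.N) {c : Fin (n + 1)} (hc : c ≠ B.col (B.v (i + 1))) :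
    gen K (B.vert (B.par i) c) * B.label i = B.label i * gen K (B.vert (B.top i) c) := by
  have hmem := B.vert_par_mem i hc
  by_cases hin : IsInner n K (B.S (i + 1))
  · rw [label, if_pos hin, mul_one, one_mul, top, dif_pos hin]
    congr 1
    have := B.vert_col (j := ⟨i + 1, by omega, hin⟩) hmem
    rwa [col_vert, eq_comm] at this
  · rw [label, if_neg hin, top, dif_neg hin]
    exact B.commute_gen (by omega) hmem (B.isBuildUp.apex_mem _ (by omega) (by omega))

/-- The labelling of the graph by the Artin group. -/
noncomputable def labelling : B.graph.Labelling (artinGroup K) where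
  t j c := gen K (B.vert j c)
  w h := if h.2 then B.label h.1 else (B.label h.1)⁻¹
  comm j c d := B.commute_gen j.2.1 (B.vert_mem j c) (B.vert_mem j d)
  w_inv h := by
    obtain ⟨i, b⟩ := h
    cases b <;> simp [graph]
  t_mul_w h c hc := by
    obtain ⟨i, b⟩ := h
    have := B.gen_vert_mul_label i hc
    cases b
    · change gen K (B.vert (B.top i) c) * (B.label i)⁻¹ =
        (B.label i)⁻¹ * gen K (B.vert (B.par i) c)
      rw [eq_inv_mul_iff_mul_eq, ← mul_assoc, ← this, mul_inv_cancel_right]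
    · exact this

lemma exists_edge_of_ne_root (j : B.Inner) (hj : j ≠ B.graph.root) :
    ∃ i : Fin B.N, j.1 = i + 1 ∧ IsInner n K (B.S (i + 1)) := by
  obtain ⟨j, hjN, hin⟩ := j
  rcases j with _ | j
  · exact absurd rfl hj
  · exact ⟨⟨j, by omega⟩, rfl, hin⟩

/-- The edge that joins an inner simplex to its parent, oriented away from the parent. -/
noncomputable def treeEdge (j : B.Inner) (hj : j ≠ B.graph.root) : Fin B.N × Bool :=
  ((B.exists_edge_of_ne_root j hj).choose, true)

lemma tgt_treeEdge (j : B.Inner) (hj : j ≠ B.graph.root) :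
    B.graph.tgt (B.treeEdge j hj) = j := by
  have h := (B.exists_edge_of_ne_root j hj).choose_spec
  change B.top (B.exists_edge_of_ne_root j hj).choose = j
  rw [top, dif_pos h.2]
  exact Subtype.ext h.1.symm

lemma src_treeEdge_lt (j : B.Inner) (hj : j ≠ B.graph.root) :
    (B.graph.src (B.treeEdge j hj)).1 < j.1 := by
  have h := (B.exists_edge_of_ne_root j hj).choose_spec
  change parent B.S B.v ((B.exists_edge_of_ne_root j hj).choose + 1) < _
  rw [← h.1]
  exact B.isBuildUp.parent_lt (by omega) j.2.1

/-- The identification of the flats at the first simplex with those at any inner simplex. -/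
noncomputable def flatEquiv (j : B.Inner) : B.graph.FlatAt B.graph.root ≃ B.graph.FlatAt j :=
  B.graph.transport (fun j => j.1) B.treeEdge B.tgt_treeEdge B.src_treeEdge_lt j

/-- On passing from the parent of an inner simplex to that simplex, flats are identified by crossing
the common face. -/
lemma toPoint_flatEquiv_top (i : Fin B.N) (hin : IsInner n K (B.S (i + 1)))
    (y : B.graph.FlatAt B.graph.root) :
    (B.flatEquiv (B.graph.tgt (i, true)) y).toPoint =
      (B.graph.cross (i, true) (B.flatEquiv (B.graph.src (i, true)) y)).toPoint := by
  set j : B.Inner := ⟨i + 1, by omega, hin⟩ with hj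
  have htop : B.graph.tgt (i, true) = j := by
    change B.top i = j
    rw [top, dif_pos hin]
  have hne : j ≠ B.graph.root := fun h => by
    have := congrArg Subtype.val h
    simp [hj, graph] at this
  have he : B.treeEdge j hne = (i, true) := by
    have h := (B.exists_edge_of_ne_root j hne).choose_spec.1
    refine Prod.ext (Fin.ext ?_) rfl
    change ((B.exists_edge_of_ne_root j hne).choose : ℕ) = i
    exact (Nat.add_right_cancel h).symm
  have hcongr : ∀ k, k = j → (B.flatEquiv k y).toPoint = (B.flatEquiv j y).toPoint := by
    rintro _ rfl
    rfl
  have key : ∀ h, B.treeEdge j hne = h → (B.flatEquiv j y).toPoint =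
      (B.graph.cross h (B.flatEquiv (B.graph.src h) y)).toPoint := by
    rintro _ rfl
    exact ColoredGraph.toPoint_transport hne y
  exact (hcongr _ htop).trans (key _ he)

/-! ### The action of the Artin group -/

/-- The permutation of the flats at the first simplex that becomes translation in the direction `c`
when it is transported to the simplex `j`. -/
noncomputable def translation (j : B.Inner) (c : Fin (n + 1)) :
    Equiv.Perm (B.graph.FlatAt B.graph.root) :=
  ((B.flatEquiv j).trans (B.graph.translate j c)).trans (B.flatEquiv j).symm

/-- The translations defined by the inner simplices that contain a vertex `u` agree with the one
defined by the first of them, since passing from a simplex to its parent keeps `u` until then. -/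
lemma translation_eq (j k : B.Inner) (hjk : j.1 ≤ k.1) {u : V} (hj : u ∈ B.S j)
    (hk : u ∈ B.S k) (hfirst : ∀ i : B.Inner, u ∈ B.S i → j.1 ≤ i.1) :
    B.translation k (B.col u) = B.translation j (B.col u) := by
  induction hr : k.1 using Nat.strong_induction_on generalizing k with
  | _ r ih =>
    rcases hjk.eq_or_lt with he | hlt
    · rw [Subtype.ext he]
    obtain ⟨i, hi, hin⟩ := B.exists_edge_of_ne_root k (fun h => by
      have := congrArg Subtype.val h
      simp only [graph] at this
      omega)
    obtain ⟨k, hkN, hkin⟩ := k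
    simp only at hi
    subst hi
    have huv : u ≠ B.v (i + 1) := by
      rintro rfl
      exact B.isBuildUp.apex_notMem _ _ hlt (by omega) hj
    have hcol : B.col u ≠ B.graph.col (i, true) := fun h => huv (B.injOn_col (i + 1) (by omega) hk
      (B.isBuildUp.apex_mem _ (by omega) (by omega)) h)
    have hpar : u ∈ B.S (B.par i) := B.isBuildUp.mem_parent (by omega) (by omega) hk huv
    have hlt' : (B.par i).1 < i + 1 := B.isBuildUp.parent_lt (by omega) (by omega)
    rw [← ih _ (hr ▸ hlt') (B.par i) (hfirst _ hpar) hpar rfl]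
    refine Equiv.ext fun y => ?_
    have htop : B.graph.tgt (i, true) = ⟨i + 1, by omega, hin⟩ := by
      change B.top i = _
      rw [top, dif_pos hin]
    have hcross : ∀ z, B.flatEquiv (B.graph.tgt (i, true)) z =
        B.graph.cross (i, true) (B.flatEquiv (B.graph.src (i, true)) z) := fun z =>
      ColoredGraph.FlatAt.toPoint_injective (B.toPoint_flatEquiv_top i hin z)
    rw [← htop]
    simp only [translation, Equiv.trans_apply]
    rw [Equiv.symm_apply_eq, hcross, hcross]
    change _ = B.graph.cross (i, true) (B.flatEquiv (B.par i) ((B.flatEquiv (B.par i)).symm _))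
    rw [Equiv.apply_symm_apply]
    exact (B.graph.cross_translate hcol _).symm

/-- The apex of a simplex that is not inner lies in no inner simplex, since a simplex that is not
inner is the parent of no other simplex. -/
lemma apex_notMem_of_isInner {i : Fin B.N} (hi : ¬ IsInner n K (B.S (i + 1))) (j : B.Inner) :
    B.v (i + 1) ∉ B.S j := by
  obtain ⟨j, hj, hin⟩ := j
  induction j using Nat.strong_induction_on with
  | _ j ih =>
    intro hmem
    have hle : i + 1 ≤ j := by
      by_contra! hlt
      exact B.isBuildUp.apex_notMem _ _ hlt (by omega) hmem
    have hne : i + 1 ≠ j := by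
      rintro rfl
      exact hi hin
    have hv : B.v (i + 1) ≠ B.v j := by
      intro he
      exact B.isBuildUp.apex_notMem j (i + 1) (by omega) hj
        (he ▸ B.isBuildUp.apex_mem (i + 1) (by omega) (by omega))
    obtain ⟨k, rfl⟩ : ∃ k, j = k + 1 := ⟨j - 1, by omega⟩
    exact ih (B.par ⟨k, by omega⟩).1 (B.isBuildUp.parent_lt (by omega) (by omega))
      (B.par ⟨k, by omega⟩).2.1 (B.par ⟨k, by omega⟩).2.2
      (B.isBuildUp.mem_parent (by omega) (by omega) hmem hv)

lemma tgt_eq_of_not_isInner {i : Fin B.N} (hi : ¬ IsInner n K (B.S (i + 1))) :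
    B.graph.tgt (i, true) = B.par i := by
  change B.top i = _
  rw [top, dif_neg hi]

/-- The permutation of the flats at the first simplex that becomes the crossing of the edge of a
simplex that is not inner when it is transported to the parent of that simplex. -/
noncomputable def loop {i : Fin B.N} (hi : ¬ IsInner n K (B.S (i + 1))) :
    Equiv.Perm (B.graph.FlatAt B.graph.root) :=
  ((B.flatEquiv (B.par i)).trans ((B.graph.cross (i, true)).trans
    (B.graph.flatCongr (B.tgt_eq_of_not_isInner hi)))).trans (B.flatEquiv (B.par i)).symm

lemma flatEquiv_loop {i : Fin B.N} (hi : ¬ IsInner n K (B.S (i + 1)))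
    (y : B.graph.FlatAt B.graph.root) :
    B.flatEquiv (B.par i) (B.loop hi y) = B.graph.flatCongr (B.tgt_eq_of_not_isInner hi)
      (B.graph.cross (i, true) (B.flatEquiv (B.graph.src (i, true)) y)) :=
  Equiv.apply_symm_apply _ _

lemma flatEquiv_translation (j : B.Inner) (c : Fin (n + 1)) (y : B.graph.FlatAt B.graph.root) :
    B.flatEquiv j (B.translation j c y) = B.graph.translate j c (B.flatEquiv j y) :=
  Equiv.apply_symm_apply _ _

lemma toPoint_loop {i : Fin B.N} (hi : ¬ IsInner n K (B.S (i + 1)))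
    (y : B.graph.FlatAt B.graph.root) :
    (B.flatEquiv (B.graph.tgt (i, true)) (B.loop hi y)).toPoint =
      (B.graph.cross (i, true) (B.flatEquiv (B.graph.src (i, true)) y)).toPoint := by
  have h : ∀ j, j = B.par i → (B.flatEquiv j (B.loop hi y)).toPoint =
      (B.graph.cross (i, true) (B.flatEquiv (B.graph.src (i, true)) y)).toPoint := by
    rintro _ rfl
    rw [B.flatEquiv_loop]
    exact B.graph.toPoint_flatCongr _ _
  exact h _ (B.tgt_eq_of_not_isInner hi)

lemma loop_translation {i : Fin B.N} (hi : ¬ IsInner n K (B.S (i + 1))) {c : Fin (n + 1)}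
    (hc : c ≠ B.col (B.v (i + 1))) :
    Commute (B.loop hi) (B.translation (B.par i) c) := by
  refine Equiv.ext fun y => (B.flatEquiv (B.par i)).injective ?_
  have h : ∀ j (hj : B.graph.tgt (i, true) = j) z, B.graph.flatCongr hj
      (B.graph.translate _ c z) = B.graph.translate j c (B.graph.flatCongr hj z) := by
    rintro _ rfl z
    rfl
  rw [Equiv.Perm.mul_apply, Equiv.Perm.mul_apply, flatEquiv_translation, flatEquiv_loop,
    flatEquiv_loop, ← h]
  refine congrArg _ (Eq.trans ?_ (B.graph.cross_translate hc _))
  exact congrArg _ (B.flatEquiv_translation _ c y)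

lemma translation_comm (j : B.Inner) (c d : Fin (n + 1)) :
    Commute (B.translation j c) (B.translation j d) := by
  refine Equiv.ext fun y => (B.flatEquiv j).injective ?_
  simp only [Equiv.Perm.mul_apply, flatEquiv_translation]
  rw [B.graph.translate_comm]

/-- Every vertex lies in an inner simplex or is the apex of a simplex that is not inner. -/
lemma mem_inner_or_apex {j : ℕ} (hj : j ≤ B.N) {u : V} (hu : u ∈ B.S j) :
    (∃ k : B.Inner, u ∈ B.S k) ∨
      ∃ i : Fin B.N, ¬ IsInner n K (B.S (i + 1)) ∧ j = i + 1 ∧ u = B.v (i + 1) := by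
  by_cases hin : IsInner n K (B.S j)
  · exact Or.inl ⟨⟨j, hj, hin⟩, hu⟩
  rcases j with _ | j
  · exact absurd B.isInner_zero hin
  by_cases huv : u = B.v (j + 1)
  · exact Or.inr ⟨⟨j, by omega⟩, hin, rfl, huv⟩
  · exact Or.inl ⟨B.par ⟨j, by omega⟩, B.isBuildUp.mem_parent (by omega) hj hu huv⟩

lemma apex_injective {i i' : Fin B.N} (h : B.v (i + 1) = B.v (i' + 1)) : i = i' := by
  by_contra hne
  rcases lt_or_gt_of_ne hne with hlt | hlt
  · exact B.isBuildUp.apex_notMem (i' + 1) (i + 1) (by omega) (by omega)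
      (h ▸ B.isBuildUp.apex_mem (i + 1) (by omega) (by omega))
  · exact B.isBuildUp.apex_notMem (i + 1) (i' + 1) (by omega) (by omega)
      (h ▸ B.isBuildUp.apex_mem (i' + 1) (by omega) (by omega))

/-- The translations and loops define one permutation for each vertex. -/
lemma exists_perm (u : Vertex K) : ∃ p : Equiv.Perm (B.graph.FlatAt B.graph.root),
    (∀ j : B.Inner, u.1 ∈ B.S j → p = B.translation j (B.col u.1)) ∧
    ∀ (i : Fin B.N) (hi : ¬ IsInner n K (B.S (i + 1))), u.1 = B.v (i + 1) → p = B.loop hi := by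
  classical
  obtain ⟨-, j, hj, huj⟩ := (B.isBuildUp.mem_faces _).1 u.2
  rw [Finset.singleton_subset_iff] at huj
  by_cases hin : ∃ k : B.Inner, u.1 ∈ B.S k
  · have hex : ∃ k, ∃ hk : k ≤ B.N ∧ IsInner n K (B.S k), u.1 ∈ B.S k := by
      obtain ⟨k, hk⟩ := hin
      exact ⟨k.1, k.2, hk⟩
    obtain ⟨hk, hu⟩ := Nat.find_spec hex
    refine ⟨B.translation ⟨_, hk⟩ (B.col u.1), fun j hj => ?_, fun i hi hui => ?_⟩
    · exact (B.translation_eq ⟨_, hk⟩ j (Nat.find_min' hex ⟨j.2, hj⟩) hu hj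
        fun i hi => Nat.find_min' hex ⟨i.2, hi⟩).symm
    · exact absurd (hui ▸ hu) (B.apex_notMem_of_isInner hi ⟨_, hk⟩)
  · obtain ⟨i, hi, -, hui⟩ := (B.mem_inner_or_apex hj huj).resolve_left hin
    refine ⟨B.loop hi, fun j hj => absurd ⟨j, hj⟩ hin, fun i' hi' hui' => ?_⟩
    obtain rfl := B.apex_injective (hui.symm.trans hui')
    rfl

/-- The permutation by which a generator acts on the flats at the first simplex. -/
noncomputable def perm (u : Vertex K) : Equiv.Perm (B.graph.FlatAt B.graph.root) :=
  (B.exists_perm u).choose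

lemma perm_of_mem {u : Vertex K} {j : B.Inner} (hj : u.1 ∈ B.S j) :
    B.perm u = B.translation j (B.col u.1) := (B.exists_perm u).choose_spec.1 j hj

lemma perm_of_apex {u : Vertex K} {i : Fin B.N} (hi : ¬ IsInner n K (B.S (i + 1)))
    (hu : u.1 = B.v (i + 1)) : B.perm u = B.loop hi := (B.exists_perm u).choose_spec.2 i hi hu

lemma commute_perm_of_apex {u u' : Vertex K} {i : Fin B.N} (hi : ¬ IsInner n K (B.S (i + 1)))
    (hu : u.1 = B.v (i + 1)) (hu' : u'.1 ∈ B.S (i + 1)) (hne : u.1 ≠ u'.1) :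
    Commute (B.perm u) (B.perm u') := by
  rw [B.perm_of_apex hi hu, B.perm_of_mem (j := B.par i)
    (B.isBuildUp.mem_parent (by omega) (by omega) hu' (by rw [← hu]; exact hne.symm))]
  refine B.loop_translation hi fun h => hne ?_
  rw [hu]
  exact (B.injOn_col _ (by omega) hu' (B.isBuildUp.apex_mem _ (by omega) (by omega)) h).symm

lemma commute_perm {u u' : Vertex K} (h : (oneSkeleton K).Adj u u') :
    Commute (B.perm u) (B.perm u') := by
  obtain ⟨hne, e, he, heq⟩ := h
  obtain ⟨-, j, hj, hej⟩ := (B.isBuildUp.mem_faces _).1 he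
  have hu : u.1 ∈ B.S j := hej (by rw [← Finset.mem_coe, heq]; simp)
  have hu' : u'.1 ∈ B.S j := hej (by rw [← Finset.mem_coe, heq]; simp)
  have hne' : u.1 ≠ u'.1 := fun h => hne (Subtype.ext h)
  by_cases hin : IsInner n K (B.S j)
  · rw [B.perm_of_mem (j := ⟨j, hj, hin⟩) hu, B.perm_of_mem (j := ⟨j, hj, hin⟩) hu']
    exact B.translation_comm _ _ _
  rcases j with _ | j
  · exact absurd B.isInner_zero hin
  by_cases huv : u.1 = B.v (j + 1)
  · exact B.commute_perm_of_apex (i := ⟨j, by omega⟩) hin huv hu' hne'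
  by_cases huv' : u'.1 = B.v (j + 1)
  · exact (B.commute_perm_of_apex (i := ⟨j, by omega⟩) hin huv' hu hne'.symm).symm
  · rw [B.perm_of_mem (j := B.par ⟨j, by omega⟩) (B.isBuildUp.mem_parent (by omega) hj hu huv),
      B.perm_of_mem (j := B.par ⟨j, by omega⟩) (B.isBuildUp.mem_parent (by omega) hj hu' huv')]
    exact B.translation_comm _ _ _

/-- The action of the Artin group from the right on the flats at the first simplex. -/
noncomputable def action : artinGroup K →* (Equiv.Perm (B.graph.FlatAt B.graph.root))ᵐᵒᵖ :=
  PresentedGroup.toGroup (f := fun u => MulOpposite.op (B.perm u)) (by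
    rintro _ ⟨u, u', h, rfl⟩
    simp only [map_mul, map_inv, FreeGroup.lift_apply_of]
    rw [mul_inv_eq_one, mul_inv_eq_iff_eq_mul, ← MulOpposite.op_mul, ← MulOpposite.op_mul,
      (B.commute_perm h).eq])

lemma action_gen {u : V} (hu : {u} ∈ K.faces) :
    (B.action (gen K u)).unop = B.perm (mkVertex hu) := by
  rw [gen_eq hu]
  exact congrArg MulOpposite.unop (PresentedGroup.toGroup.of _)

/-- The Cayley graph of the Artin group is coarsely equivalent to the graph of flats. -/
theorem coarselyEquivalent_flatGraph :
    SimpleGraph.CoarselyEquivalent (SimpleGraph.mulCayley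
      (Set.range (PresentedGroup.of : Vertex K → artinGroup K))) B.graph.flatGraph := by
  have hvert : ∀ (j : B.Inner) c, {B.vert j c} ∈ K.faces := fun j c =>
    B.singleton_mem j.2.1 (B.vert_mem j c)
  have hapex : ∀ i : Fin B.N, {B.v (i + 1)} ∈ K.faces := fun i =>
    B.singleton_mem (j := i + 1) (by omega) (B.isBuildUp.apex_mem _ (by omega) (by omega))
  have hw : ∀ (i : Fin B.N) y, (B.flatEquiv (B.graph.tgt (i, true))
      ((B.action (B.labelling.w (i, true))).unop y)).toPoint =
      (B.graph.cross (i, true) (B.flatEquiv (B.graph.src (i, true)) y)).toPoint := by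
    intro i y
    change (B.flatEquiv _ ((B.action (B.label i)).unop y)).toPoint = _
    by_cases hin : IsInner n K (B.S (i + 1))
    · rw [label, if_pos hin, map_one]
      exact B.toPoint_flatEquiv_top i hin y
    · rw [label, if_neg hin, B.action_gen (hapex i), B.perm_of_apex (u := mkVertex (hapex i)) hin rfl]
      exact B.toPoint_loop hin y
  refine B.labelling.coarselyEquivalent (PresentedGroup.closure_range_of _) B.flatEquiv B.N
    ColoredGraph.transport_root
    (fun j y => SimpleGraph.edist_le_of_le (ColoredGraph.edist_transport_le j y) j.2.1)
    (B.labelling.eval_transport fun j hj => ?_) B.action (fun j c y => ?_) ?_ ?_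
    (fun j c => ?_) ?_
  · exact if_pos (B.exists_edge_of_ne_root j hj).choose_spec.2
  · change B.flatEquiv j ((B.action (gen K (B.vert j c))).unop y) = _
    rw [B.action_gen (hvert j c),
      B.perm_of_mem (u := mkVertex (hvert j c)) (B.vert_mem j c), flatEquiv_translation]
    exact congrArg (fun d => B.graph.translate j d _) (B.col_vert j c)
  · rintro ⟨i, b⟩ y
    cases b
    · exact B.labelling.toPoint_apply_inv (h := (i, true)) (hw i) y
    · exact hw i y
  · rintro _ ⟨u, rfl⟩
    obtain ⟨-, j, hj, huj⟩ := (B.isBuildUp.mem_faces _).1 u.2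
    rw [Finset.singleton_subset_iff] at huj
    rcases B.mem_inner_or_apex hj huj with ⟨k, hk⟩ | ⟨i, hi, -, hui⟩
    · refine Or.inl ⟨k, B.col u.1, ?_⟩
      change _ = gen K (B.vert k (B.col u.1))
      rw [B.vert_col hk, gen_eq u.2]
      rfl
    · refine Or.inr ⟨(i, true), ?_⟩
      change _ = B.label i
      rw [label, if_neg hi, ← hui, gen_eq u.2]
      rfl
  · change gen K (B.vert j c) ∈ _
    rw [gen_eq (hvert j c)]
    exact ⟨_, rfl⟩
  · have hl : ∀ i, B.label i ∈ Set.range (PresentedGroup.of : Vertex K → artinGroup K) ∨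
        B.label i = 1 := by
      intro i
      by_cases hin : IsInner n K (B.S (i + 1))
      · exact Or.inr (if_pos hin)
      · rw [label, if_neg hin, gen_eq (hapex i)]
        exact Or.inl ⟨_, rfl⟩
    rintro ⟨i, b⟩
    cases b
    · change (B.label i)⁻¹ ∈ _ ∨ (B.label i)⁻¹⁻¹ ∈ _ ∨ (B.label i)⁻¹ = 1
      rw [inv_inv, inv_eq_one]
      exact Or.inr (hl i)
    · exact (hl i).imp_right Or.inr

lemma finite_vertex (B : Branching n K) : Finite (Vertex K) := by
  classical
  refine Set.Finite.to_subtype (s := {u | {u} ∈ K.faces}) ?_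
  refine ((Finset.range (B.N + 1)).biUnion B.S).finite_toSet.subset fun u hu => ?_
  obtain ⟨-, j, hj, huj⟩ := (B.isBuildUp.mem_faces _).1 hu
  rw [Finset.singleton_subset_iff] at huj
  simp only [Finset.coe_biUnion, Finset.coe_range, Set.mem_Iio, Set.mem_iUnion, exists_prop]
  exact ⟨j, by omega, huj⟩

theorem coarselyEquivalent_modelGraph (B : Branching n K) :
    SimpleGraph.CoarselyEquivalent (SimpleGraph.mulCayley
      (Set.range (PresentedGroup.of : Vertex K → artinGroup K))) (modelGraph (n + 1)) :=
  B.coarselyEquivalent_flatGraph.trans (B.graph.coarselyEquivalent_modelGraph B.exists_src_eq)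

end Branching

end NTree

theorem corollary1p2 {V : Type*} {V' : Type*} (n : ℕ)
    (K : PreAbstractSimplicialComplex V) (K' : PreAbstractSimplicialComplex V')
    (hK : NTree.IsTreeComplex n K) (hK' : NTree.IsTreeComplex n K')
    (hirr : ¬ NTree.IsReducible K) (hirr' : ¬ NTree.IsReducible K')
    (hmax : NTree.IsMaximallyBranched n K) (hmax' : NTree.IsMaximallyBranched n K') :
    AreQuasiIsometricGroups (NTree.artinGroup K) (NTree.artinGroup K') := by
  obtain ⟨B⟩ := hK.nonempty_branching hirr hmax
  obtain ⟨B'⟩ := hK'.nonempty_branching hirr' hmax'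
  have := B.finite_vertex
  have := B'.finite_vertex
  exact (B.coarselyEquivalent_modelGraph.trans
    B'.coarselyEquivalent_modelGraph.symm).areQuasiIsometricGroups
    (Set.finite_range _) (Set.finite_range _) (PresentedGroup.closure_range_of _)
    (PresentedGroup.closure_range_of _)
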